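/- Let $\alpha\in(0,2)$ and, on a probability space $(\Omega,\mathcal F,\mathsf P)$, let $(\Gamma_k)_{k\ge1}$, $(\xi_k)_{k\ge1}$, $(g_k)_{k\ge1}$ be three independent families of random variables: $\Gamma_1,\Gamma_2,\dots$ are the arrival times of a Poisson process with unit intensity; $\xi_1,\xi_2,\dots$ are independent random points of $\mathbb R^2$ with a continuous, everywhere positive probability density $\varphi$; and $g_1,g_2,\dots$ are independent centered Gaussian variables with $\mathsf E|g_k|^\alpha=1$. Let $M$ be the symmetric $\alpha$-stable random measure on $\mathbb R^2$ with Lebesgue control measure given by its LePage series, so that $$\int_{\mathbb R^2} f(y)\,M(dy)=C_\alpha\sum_{k\ge1}\Gamma_k^{-1/\alpha}\varphi(\xi_k)^{-1/\alpha}f(\xi_k)\,g_k,\qquad C_\alpha=\Big(\frac{1-\alpha}{\mathit\Gamma(2-\alpha)\cos(\pi\alpha/2)}\Big)^{1/\alpha}\quad(C_1=2/\pi),$$ the sum being the limit of the partial sums over $k\le N$ as $N\to\infty$; here $\mathit\Gamma$ is the Gamma function. Let $a>0$ and let $\sigma:\mathbb R^2\times[0,\infty)\to\mathbb R$ be (S1)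 bounded, (S2) continuous, and (S3) Hölder continuous in time: for some $\gamma\in(0,1]$ and some constant $L$, $|\sigma(y,t)-\sigma(y,s)|\le L|t-s|^\gamma$ for all $t,s\ge0$ and $y\in\mathbb R^2$. Put $$G(x,y,t)=\frac{\mathbf 1_{\{|x-y|<at\}}}{2\pi a}\int_0^{t-|x-y|/a}\frac{\sigma(y,\tau)\,d\tau}{\sqrt{a^2(t-\tau)^2-|y-x|^2}},\qquad U(x,t)=\int_{\mathbb R^2}G(x,y,t)\,M(dy),$$ the candidate solution, given by Poisson's formula, of the planar wave equation $(\partial_t^2-a^2\Delta)U=\sigma\dot M$ with zero initial conditions. Let $\beta=\gamma\wedge\frac12$. Then for every $T>0$ and every $x\in\mathbb R^2$: almost surely the series defining $U(x,t)$ converges for all $t\in[0,T]$, and the path $t\mapsto U(x,t)$ is Hölder continuous on $[0,T]$ with every exponent smaller than $\beta$. Moreover, for every $\eta>0$ there is a finite random variable $C=C(\omega)$ such that, almost surely, $$|U(x,t_1)-U(x,t_2)|\le C(\omega)\,|t_1-t_2|^{\beta}\,\big|\ln|t_1-t_2|\big|^{1+\eta/2}$$ for all $t_1,t_2\in[0,T]$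 with $0<|t_1-t_2|\le\frac12$. -/

import Mathlib

open MeasureTheory ProbabilityTheory Filter Topology Set
open scoped NNReal

noncomputable section

/-- The Euclidean plane. -/
abbrev Plane : Type := EuclideanSpace ℝ (Fin 2)

/-- The waiting times `Γ 0, Γ 1 - Γ 0, Γ 2 - Γ 1, …` of a sequence of arrival times. -/
def waitingTime {Ω : Type*} (Γ : ℕ → Ω → ℝ) (k : ℕ) (ω : Ω) : ℝ :=
  if k = 0 then Γ 0 ω else Γ k ω - Γ (k - 1) ω

/-- The sequence `Γ 0, Γ 1, …` is the sequence of arrival times of a Poisson process with unit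
intensity: its waiting times are independent, each with the exponential distribution of rate
one. -/
structure IsUnitPoissonArrivals {Ω : Type*} [MeasurableSpace Ω] (P : Measure Ω)
    (Γ : ℕ → Ω → ℝ) : Prop where
  measurable : ∀ k, Measurable (Γ k)
  law : ∀ k, P.map (waitingTime Γ k) = expMeasure 1
  indep : iIndepFun (waitingTime Γ) P

/-- The ingredients of the LePage representation of a planar symmetric `α`-stable random measure
with Lebesgue control measure: three independent families, consisting of the arrivals `Γ` of a
unit Poisson process, independent points `ξ` of the plane with the continuous positive density `φ`,
and independent centered Gaussian variables `g` with `E |g k| ^ α = 1`. -/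
structure IsLePageSystem {Ω : Type*} [MeasurableSpace Ω] (P : Measure Ω) (α : ℝ) (φ : Plane → ℝ)
    (Γ : ℕ → Ω → ℝ) (ξ : ℕ → Ω → Plane) (g : ℕ → Ω → ℝ) : Prop where
  density_continuous : Continuous φ
  density_pos : ∀ y, 0 < φ y
  arrivals : IsUnitPoissonArrivals P Γ
  point_measurable : ∀ k, Measurable (ξ k)
  point_law : ∀ k, P.map (ξ k) = volume.withDensity (fun y => ENNReal.ofReal (φ y))
  point_indep : iIndepFun ξ P
  gauss_measurable : ∀ k, Measurable (g k)
  gauss_law : ∀ k, ∃ v : ℝ≥0, P.map (g k) = gaussianReal 0 v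
  gauss_moment : ∀ k, ∫ ω, |g k ω| ^ α ∂P = 1
  gauss_indep : iIndepFun g P
  /-- The families `ξ` and `g` are independent of each other. -/
  indep_points_gauss : IndepFun (fun ω k => ξ k ω) (fun ω k => g k ω) P
  /-- The family `Γ` is independent of the other two taken together. -/
  indep_arrivals : IndepFun (fun ω k => Γ k ω) (fun ω => ((fun k => ξ k ω), (fun k => g k ω))) P

/-- The normalizing constant of the LePage series: the number
`(∫₀^∞ u ^ (-α) sin u du) ^ (-1 / α)`, in closed form (the value at `α = 1` is the limit). -/
def lePageConst (α : ℝ) : ℝ :=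
  if α = 1 then 2 / Real.pi
  else ((1 - α) / (Real.Gamma (2 - α) * Real.cos (Real.pi * α / 2))) ^ (1 / α)

/-- The partial sum, over the first `N` terms, of the LePage series of `∫ f dM`. -/
def lePagePartialSum {Ω : Type*} (α : ℝ) (φ : Plane → ℝ) (Γ : ℕ → Ω → ℝ) (ξ : ℕ → Ω → Plane)
    (g : ℕ → Ω → ℝ) (f : Plane → ℝ) (N : ℕ) (ω : Ω) : ℝ :=
  lePageConst α * ∑ k ∈ Finset.range N,
    Γ k ω ^ (-(1 / α)) * φ (ξ k ω) ^ (-(1 / α)) * f (ξ k ω) * g k ω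

/-- The integral `∫ f dM` with respect to the symmetric `α`-stable random measure `M` given by
the LePage series: the limit of the partial sums (an arbitrary value where they diverge). -/
def lePageIntegral {Ω : Type*} (α : ℝ) (φ : Plane → ℝ) (Γ : ℕ → Ω → ℝ) (ξ : ℕ → Ω → Plane)
    (g : ℕ → Ω → ℝ) (f : Plane → ℝ) (ω : Ω) : ℝ :=
  limUnder atTop (fun N => lePagePartialSum α φ Γ ξ g f N ω)

/-- The kernel `G(x, y, t)` of Poisson's formula for the planar wave equation with speed `a` and
coefficient `σ`. -/
def waveKernel (a : ℝ) (σ : Plane → ℝ → ℝ) (x y : Plane) (t : ℝ) : ℝ :=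
  if ‖x - y‖ < a * t then
    1 / (2 * Real.pi * a) *
      ∫ τ in (0 : ℝ)..(t - ‖x - y‖ / a), σ y τ / √(a ^ 2 * (t - τ) ^ 2 - ‖y - x‖ ^ 2)
  else 0

/-- The candidate solution `U(x, t) = ∫ G(x, y, t) M(dy)`. -/
def candidateSolution {Ω : Type*} (α : ℝ) (φ : Plane → ℝ) (Γ : ℕ → Ω → ℝ) (ξ : ℕ → Ω → Plane)
    (g : ℕ → Ω → ℝ) (a : ℝ) (σ : Plane → ℝ → ℝ) (x : Plane) (t : ℝ) (ω : Ω) : ℝ :=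
  lePageIntegral α φ Γ ξ g (fun y => waveKernel a σ x y t) ω

end

/-! Conditionally on the arrivals and the points, the LePage series is a series of deterministic
functions of time with independent Gaussian weights of common variance. The proof combines a
deterministic estimate on the kernel with a chaining argument for such series.

Kernel. After the substitution `u = t - τ`, time enters only through `σ` and the upper limit, while
the singular profile `(a²u² - r²)^(-1/2)` stays fixed. The profile is at most `r^(-1/2) (au -
r)^(-1/2)`, so its mass on `[s, t]` is `O(r^(-1/2) (t - s)^(1/2))`. Hence the kernel is `β`-Hölder
in time with constant `D r^(-1/2)` on `r < aT` and zero beyond (`exists_abs_waveKernel_sub_le`). The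
square of `r^(-1/2)` is locally integrable in the plane. As `Γ k` grows linearly and `2/α > 1`, the
weighted Hölder constants are almost surely square summable (`ae_summable_lePage_sq`).

Gaussian series. Doob's inequality for the exponential of the partial sums bounds their supremum
with tail `2 exp(1/2 - u)`. At dyadic level `m` there are `2^m` increments, and taking `u = m + 1`
suffices for Borel–Cantelli because `e > 2`. All partial sums then have level-`m` increments `O((m +
1) 2^(-βm))`, uniformly in their length (`ae_bddAbove_dyadicRatio`). Chaining turns this into the
modulus `h^β (1 + |log h|)`; its uniformity carries convergence from dyadic times to all times and
lets the modulus pass to the limit. The logarithm has power one, which is below `1 + η/2`.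

Fubini on the sequence space (`ae_mem_of_indepFun`) removes the conditioning. -/

/-! ### Integrals of the inverse square root and of the wave profile -/

theorem Real.rpow_neg_half_eq_inv_sqrt (x : ℝ) : x ^ (-(1 / 2) : ℝ) = (√x)⁻¹ := by
  rcases lt_or_ge x 0 with hx | hx
  · have h : Real.cos (-(1 / 2) * Real.pi) = 0 := by
      rw [neg_mul, Real.cos_neg, one_div_mul_eq_div, Real.cos_pi_div_two]
    rw [Real.rpow_def_of_neg hx, h, mul_zero, Real.sqrt_eq_zero_of_nonpos hx.le, inv_zero]
  · rw [Real.rpow_neg hx, ← Real.sqrt_eq_rpow]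

theorem intervalIntegrable_inv_sqrt (s t : ℝ) :
    IntervalIntegrable (fun u : ℝ => (√u)⁻¹) volume s t := by
  have h := intervalIntegral.intervalIntegrable_rpow' (a := s) (b := t)
    (show (-1 : ℝ) < -(1 / 2) by norm_num)
  simpa only [Real.rpow_neg_half_eq_inv_sqrt] using h

theorem integral_inv_sqrt (s t : ℝ) : ∫ u in s..t, (√u)⁻¹ = 2 * (√t - √s) := by
  have h := integral_rpow (a := s) (b := t) (Or.inl (show (-1 : ℝ) < -(1 / 2) by norm_num))
  simp only [Real.rpow_neg_half_eq_inv_sqrt] at h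
  rw [h, show (-(1 / 2) + 1 : ℝ) = 1 / 2 by norm_num, ← Real.sqrt_eq_rpow, ← Real.sqrt_eq_rpow]
  ring

theorem intervalIntegrable_inv_sqrt_mul_sub {a : ℝ} (ha : 0 < a) (r s t : ℝ) :
    IntervalIntegrable (fun u : ℝ => (√(a * u - r))⁻¹) volume s t := by
  have h := (intervalIntegrable_inv_sqrt (a * s - r) (a * t - r)).comp_sub_right r
  simp only [sub_add_cancel] at h
  have h2 := h.comp_mul_left (c := a)
  rwa [mul_div_cancel_left₀ _ ha.ne', mul_div_cancel_left₀ _ ha.ne'] at h2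

theorem Real.sqrt_sub_sqrt_le_sqrt_sub (s t : ℝ) (hst : s ≤ t) : √t - √s ≤ √(t - s) := by
  rcases lt_or_ge s 0 with hs | hs
  · rw [Real.sqrt_eq_zero_of_nonpos hs.le, sub_zero]
    exact Real.sqrt_le_sqrt (by linarith)
  · rw [sub_le_iff_le_add, Real.sqrt_le_iff]
    refine ⟨by positivity, ?_⟩
    rw [add_sq, Real.sq_sqrt hs, Real.sq_sqrt (sub_nonneg.2 hst)]
    have : 0 ≤ 2 * √(t - s) * √s := by positivity
    linarith

/-- Subadditivity of the square root makes the bound independent of `r`, that is, of where the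
singularity lies relative to the interval. -/
theorem integral_inv_sqrt_mul_sub_le {a : ℝ} (ha : 0 < a) (r : ℝ) {s t : ℝ} (hst : s ≤ t) :
    ∫ u in s..t, (√(a * u - r))⁻¹ ≤ 2 / a * √(a * (t - s)) := by
  rw [intervalIntegral.integral_comp_mul_sub (fun u => (√u)⁻¹) ha.ne', integral_inv_sqrt,
    smul_eq_mul]
  have h := Real.sqrt_sub_sqrt_le_sqrt_sub (a * s - r) (a * t - r)
    (by have := mul_le_mul_of_nonneg_left hst ha.le; linarith)
  rw [show a * t - r - (a * s - r) = a * (t - s) by ring] at h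
  have ha' : 0 < a⁻¹ := inv_pos.2 ha
  calc a⁻¹ * (2 * (√(a * t - r) - √(a * s - r))) ≤ a⁻¹ * (2 * √(a * (t - s))) := by gcongr
    _ = _ := by ring

/-- The temporal profile of the planar wave kernel at distance `r` from the source. -/
noncomputable def planarProfile (a r u : ℝ) : ℝ := (√(a ^ 2 * u ^ 2 - r ^ 2))⁻¹

theorem planarProfile_nonneg (a r u : ℝ) : 0 ≤ planarProfile a r u :=
  inv_nonneg.2 (Real.sqrt_nonneg _)

/-- Before the wave arrives the radicand is nonpositive, and the default values of `√` and `⁻¹` give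
zero. Integrals over the whole of `[0, t]` therefore see only the time after arrival. -/
theorem planarProfile_eq_zero {a r u : ℝ} (hu : 0 ≤ a * u) (h : a * u ≤ r) :
    planarProfile a r u = 0 := by
  rw [planarProfile, Real.sqrt_eq_zero_of_nonpos, inv_zero]
  nlinarith

/-- Factor the radicand as `(au + r)(au - r)` and use `au + r ≥ r`. This separates the spatial
singularity from the temporal one. -/
theorem planarProfile_le {a r u : ℝ} (hr : 0 < r) (hu : 0 ≤ a * u) :
    planarProfile a r u ≤ (√r)⁻¹ * (√(a * u - r))⁻¹ := by
  rcases le_or_gt (a * u) r with h | h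
  · rw [planarProfile_eq_zero hu h]
    positivity
  · rw [planarProfile, ← mul_inv, ← Real.sqrt_mul hr.le]
    have : 0 < a * u - r := by linarith
    apply inv_anti₀
    · positivity
    · apply Real.sqrt_le_sqrt
      nlinarith

theorem measurable_planarProfile (a r : ℝ) : Measurable (planarProfile a r) := by
  unfold planarProfile
  fun_prop

theorem intervalIntegrable_planarProfile {a r : ℝ} (ha : 0 < a) (hr : 0 < r) {s t : ℝ}
    (hs : 0 ≤ s) (ht : 0 ≤ t) : IntervalIntegrable (planarProfile a r) volume s t := by
  refine ((intervalIntegrable_inv_sqrt_mul_sub ha r s t).const_mul (√r)⁻¹).mono_fun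
    (measurable_planarProfile a r).aestronglyMeasurable ?_
  refine (ae_restrict_mem measurableSet_uIoc).mono fun u hu => ?_
  have hu0 : 0 ≤ u := (le_min hs ht).trans hu.1.le
  simp only [Real.norm_of_nonneg (planarProfile_nonneg _ _ _)]
  exact (planarProfile_le hr (by positivity)).trans (le_abs_self _)

theorem integral_planarProfile_le {a r : ℝ} (ha : 0 < a) (hr : 0 < r) {s t : ℝ}
    (hs : 0 ≤ s) (hst : s ≤ t) :
    ∫ u in s..t, planarProfile a r u ≤ (√r)⁻¹ * (2 / a * √(a * (t - s))) := by
  calc ∫ u in s..t, planarProfile a r u ≤ ∫ u in s..t, (√r)⁻¹ * (√(a * u - r))⁻¹ := by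
        refine intervalIntegral.integral_mono_on hst
          (intervalIntegrable_planarProfile ha hr hs (hs.trans hst))
          ((intervalIntegrable_inv_sqrt_mul_sub ha r s t).const_mul _) fun u hu => ?_
        have hu0 : 0 ≤ u := hs.trans hu.1
        exact planarProfile_le hr (by positivity)
    _ ≤ _ := by
        rw [intervalIntegral.integral_const_mul]
        exact mul_le_mul_of_nonneg_left (integral_inv_sqrt_mul_sub_le ha r hst) (by positivity)

/-! ### Hölder continuity and measurability of the wave kernel -/

section Kernel

variable {a : ℝ} {σ : Plane → ℝ → ℝ}

theorem intervalIntegrable_mul_planarProfile (ha : 0 < a)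
    (hc : ∀ y, ContinuousOn (σ y) (Ici 0)) (y : Plane) {r s t t' : ℝ}
    (hr : 0 < r) (hs : 0 ≤ s) (hst : s ≤ t) (ht : t ≤ t') :
    IntervalIntegrable (fun u => σ y (t' - u) * planarProfile a r u) volume s t := by
  refine (intervalIntegrable_planarProfile ha hr hs (hs.trans hst)).continuousOn_mul ?_
  refine (hc y).comp (by fun_prop) fun u hu => ?_
  rw [uIcc_of_le hst] at hu
  exact sub_nonneg.2 (hu.2.trans ht)

/-- Reversing time fixes the location of the singularity, so that time increments never require
differences of the profile. -/
theorem waveKernel_eq_integral_planarProfile (ha : 0 < a)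
    (hc : ∀ y, ContinuousOn (σ y) (Ici 0)) {x y : Plane} (hxy : 0 < ‖x - y‖) {t : ℝ}
    (ht : 0 ≤ t) :
    waveKernel a σ x y t =
      1 / (2 * Real.pi * a) * ∫ u in (0 : ℝ)..t, σ y (t - u) * planarProfile a ‖x - y‖ u := by
  have hz : ∀ b, b ≤ ‖x - y‖ / a → 0 ≤ b →
      ∫ u in (0 : ℝ)..b, σ y (t - u) * planarProfile a ‖x - y‖ u = 0 := by
    intro b hb hb0
    refine intervalIntegral.integral_zero_ae (Eventually.of_forall fun u hu => ?_)
    rw [uIoc_of_le hb0] at hu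
    have h1 : a * u ≤ ‖x - y‖ := by
      have := hu.2.trans hb
      rw [le_div_iff₀ ha] at this
      linarith
    rw [planarProfile_eq_zero (mul_nonneg ha.le hu.1.le) h1, mul_zero]
  rw [waveKernel]
  split_ifs with h
  · congr 1
    have h0 : 0 ≤ ‖x - y‖ / a := by positivity
    have hle : ‖x - y‖ / a ≤ t := by
      rw [div_le_iff₀ ha]
      linarith
    rw [← intervalIntegral.integral_add_adjacent_intervals
      (intervalIntegrable_mul_planarProfile ha hc y hxy le_rfl h0 hle)
      (intervalIntegrable_mul_planarProfile ha hc y hxy h0 hle le_rfl), hz _ le_rfl h0, zero_add]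
    have := intervalIntegral.integral_comp_sub_left (a := 0) (b := t - ‖x - y‖ / a)
      (fun u => σ y (t - u) * planarProfile a ‖x - y‖ u) t
    rw [sub_zero, sub_sub_cancel] at this
    rw [← this]
    refine intervalIntegral.integral_congr fun τ _ => ?_
    simp only [planarProfile, sub_sub_cancel, norm_sub_rev y x, div_eq_mul_inv]
  · rw [hz t _ ht, mul_zero]
    rw [le_div_iff₀ ha]
    linarith

theorem waveKernel_eq_zero {x y : Plane} {t : ℝ} (h : a * t ≤ ‖x - y‖) :
    waveKernel a σ x y t = 0 := if_neg (not_lt.2 h)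

/-- On `[0, s]` only `σ` changes, which costs `(t - s)^γ`. On `[s, t]` the function `σ` is merely
bounded and the mass of the profile gives the square root. -/
theorem abs_waveKernel_sub_le (ha : 0 < a) (hc : ∀ y, ContinuousOn (σ y) (Ici 0)) {K L γ : ℝ}
    (hK : ∀ y t, 0 ≤ t → |σ y t| ≤ K)
    (hL : ∀ y t s, 0 ≤ t → 0 ≤ s → |σ y t - σ y s| ≤ L * |t - s| ^ γ)
    {x y : Plane} (hxy : 0 < ‖x - y‖) {s t T : ℝ} (hs : 0 ≤ s) (hst : s ≤ t) (ht : t ≤ T) :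
    |waveKernel a σ x y t - waveKernel a σ x y s| ≤
      1 / (2 * Real.pi * a) * ((√‖x - y‖)⁻¹ *
        (2 / a * (|L| * (t - s) ^ γ * √(a * T) + K * √(a * (t - s))))) := by
  have ht0 := hs.trans hst
  have hK0 : 0 ≤ K := (abs_nonneg _).trans (hK y 0 le_rfl)
  set r := ‖x - y‖
  have hh : 0 ≤ (t - s) ^ γ := Real.rpow_nonneg (sub_nonneg.2 hst) _
  have i1 := intervalIntegrable_mul_planarProfile ha hc y hxy le_rfl hs hst
  have i2 := intervalIntegrable_mul_planarProfile ha hc y hxy hs hst le_rfl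
  have i3 := intervalIntegrable_mul_planarProfile ha hc y hxy le_rfl hs le_rfl
  rw [waveKernel_eq_integral_planarProfile ha hc hxy ht0,
    waveKernel_eq_integral_planarProfile ha hc hxy hs, ← mul_sub, abs_mul,
    abs_of_nonneg (by positivity : 0 ≤ 1 / (2 * Real.pi * a))]
  refine mul_le_mul_of_nonneg_left ?_ (by positivity)
  rw [← intervalIntegral.integral_add_adjacent_intervals i1 i2, add_sub_right_comm,
    ← intervalIntegral.integral_sub i1 i3]
  have e1 : |∫ u in (0 : ℝ)..s, σ y (t - u) * planarProfile a r u - σ y (s - u) * planarProfile a r u| ≤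
      |L| * (t - s) ^ γ * ((√r)⁻¹ * (2 / a * √(a * T))) := by
    have hb : ∀ u ∈ Ioc 0 s, ‖σ y (t - u) * planarProfile a r u - σ y (s - u) * planarProfile a r u‖ ≤
        |L| * (t - s) ^ γ * planarProfile a r u := by
      intro u hu
      rw [← sub_mul, norm_mul, Real.norm_of_nonneg (planarProfile_nonneg _ _ _)]
      refine mul_le_mul_of_nonneg_right ?_ (planarProfile_nonneg _ _ _)
      have := hL y (t - u) (s - u) (by linarith [hu.2]) (by linarith [hu.2])
      rw [sub_sub_sub_cancel_right, abs_of_nonneg (sub_nonneg.2 hst)] at this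
      exact this.trans (mul_le_mul_of_nonneg_right (le_abs_self L) hh)
    have := intervalIntegral.norm_integral_le_of_norm_le hs (Eventually.of_forall hb)
      ((intervalIntegrable_planarProfile ha hxy le_rfl hs).const_mul _)
    rw [intervalIntegral.integral_const_mul] at this
    refine this.trans (mul_le_mul_of_nonneg_left ?_ (by positivity))
    refine (integral_planarProfile_le ha hxy le_rfl hs).trans ?_
    rw [sub_zero]
    gcongr
    exact hst.trans ht
  have e2 : |∫ u in s..t, σ y (t - u) * planarProfile a r u| ≤
      K * ((√r)⁻¹ * (2 / a * √(a * (t - s)))) := by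
    have hb : ∀ u ∈ Ioc s t, ‖σ y (t - u) * planarProfile a r u‖ ≤ K * planarProfile a r u := by
      intro u hu
      rw [norm_mul, Real.norm_of_nonneg (planarProfile_nonneg _ _ _)]
      exact mul_le_mul_of_nonneg_right (hK y _ (by linarith [hu.2])) (planarProfile_nonneg _ _ _)
    have := intervalIntegral.norm_integral_le_of_norm_le hst (Eventually.of_forall hb)
      ((intervalIntegrable_planarProfile ha hxy hs ht0).const_mul _)
    rw [intervalIntegral.integral_const_mul] at this
    exact this.trans (mul_le_mul_of_nonneg_left (integral_planarProfile_le ha hxy hs hst) hK0)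
  refine (abs_add_le _ _).trans ((add_le_add e1 e2).trans (le_of_eq ?_))
  ring

theorem Real.rpow_le_mul_rpow_of_le {h T γ β : ℝ} (hh : 0 ≤ h) (hT : h ≤ T) (hβ : 0 < β)
    (hβγ : β ≤ γ) : h ^ γ ≤ T ^ (γ - β) * h ^ β := by
  rcases hh.eq_or_lt with rfl | hpos
  · rw [Real.zero_rpow (hβ.trans_le hβγ).ne', Real.zero_rpow hβ.ne', mul_zero]
  · calc h ^ γ = h ^ (γ - β) * h ^ β := by rw [← Real.rpow_add hpos, sub_add_cancel]
      _ ≤ _ := by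
        refine mul_le_mul_of_nonneg_right (Real.rpow_le_rpow hh hT (by linarith)) (by positivity)

/-- The planar wave kernel is Hölder continuous in time, with a constant which is an explicit
square integrable function of the distance to the source. -/
theorem exists_abs_waveKernel_sub_le (ha : 0 < a) (hc : ∀ y, ContinuousOn (σ y) (Ici 0))
    {γ T : ℝ} (hγ : 0 < γ)
    (hK : ∃ K : ℝ, ∀ y t, 0 ≤ t → |σ y t| ≤ K)
    (hL : ∃ L : ℝ, ∀ y t s, 0 ≤ t → 0 ≤ s → |σ y t - σ y s| ≤ L * |t - s| ^ γ)
    (x : Plane) :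
    ∃ D : ℝ, 0 ≤ D ∧ ∀ y : Plane, 0 < ‖x - y‖ → ∀ s ∈ Icc 0 T, ∀ t ∈ Icc 0 T,
      |waveKernel a σ x y t - waveKernel a σ x y s| ≤
        D * (Iio (a * T)).indicator (fun r => (√r)⁻¹) ‖x - y‖ * |t - s| ^ min γ (1 / 2) := by
  obtain ⟨K, hK⟩ := hK
  obtain ⟨L, hL⟩ := hL
  have hK0 : 0 ≤ K := (abs_nonneg _).trans (hK 0 0 le_rfl)
  set β := min γ (1 / 2) with hβ
  have hβ0 : 0 < β := lt_min hγ (by norm_num)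
  -- The sign of `T` is not assumed; `|T|` keeps the constant nonnegative, and for `T < 0` there are
  -- no times to compare.
  refine ⟨1 / (2 * Real.pi * a) * (2 / a * (|L| * (|T| ^ (γ - β)) * √(a * |T|) +
    K * (√a * |T| ^ (1 / 2 - β)))), by positivity, fun y hxy => ?_⟩
  have key : ∀ s ∈ Icc 0 T, ∀ t ∈ Icc 0 T, s ≤ t →
      |waveKernel a σ x y t - waveKernel a σ x y s| ≤
        1 / (2 * Real.pi * a) * (2 / a * (|L| * (|T| ^ (γ - β)) * √(a * |T|) +
        K * (√a * |T| ^ (1 / 2 - β)))) *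
        (Iio (a * T)).indicator (fun r => (√r)⁻¹) ‖x - y‖ * |t - s| ^ β := by
    intro s hs t ht hst
    by_cases hr : ‖x - y‖ < a * T
    · rw [indicator_of_mem (by exact hr), abs_of_nonneg (sub_nonneg.2 hst)]
      refine (abs_waveKernel_sub_le ha hc hK hL hxy hs.1 hst ht.2).trans ?_
      have hT : 0 ≤ T := ht.1.trans ht.2
      have h0 : 0 ≤ t - s := sub_nonneg.2 hst
      have h1 : t - s ≤ T := by linarith [ht.2, hs.1]
      rw [abs_of_nonneg hT, Real.sqrt_mul ha.le (t - s), Real.sqrt_eq_rpow (t - s)]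
      have b1 := Real.rpow_le_mul_rpow_of_le h0 h1 hβ0 (min_le_left γ (1 / 2))
      have b2 := Real.rpow_le_mul_rpow_of_le h0 h1 hβ0 (min_le_right γ (1 / 2))
      calc _ ≤ 1 / (2 * Real.pi * a) * ((√‖x - y‖)⁻¹ *
          (2 / a * (|L| * (T ^ (γ - β) * (t - s) ^ β) * √(a * T) +
            K * (√a * (T ^ (1 / 2 - β) * (t - s) ^ β))))) := by gcongr
        _ = _ := by ring
    · have hr' := not_lt.1 hr
      rw [indicator_of_notMem (by exact hr),
        waveKernel_eq_zero ((mul_le_mul_of_nonneg_left ht.2 ha.le).trans hr'),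
        waveKernel_eq_zero ((mul_le_mul_of_nonneg_left hs.2 ha.le).trans hr')]
      simp
  intro s hs t ht
  rcases le_total s t with h | h
  · exact key s hs t ht h
  · rw [abs_sub_comm, abs_sub_comm t s]
    exact key t ht s hs h

theorem measurable_waveKernel (ha : 0 < a)
    (hc : ContinuousOn (fun p : Plane × ℝ => σ p.1 p.2) (univ ×ˢ Ici (0 : ℝ)))
    (x : Plane) (t : ℝ) : Measurable fun y => waveKernel a σ x y t := by
  -- Freezing `σ` at its time-zero value for negative times extends it continuously to all times.
  have hcont : Continuous fun p : Plane × ℝ => σ p.1 (max p.2 0) := by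
    refine hc.comp_continuous (f := fun p : Plane × ℝ => (p.1, max p.2 0)) (by fun_prop) ?_
    intro p
    exact ⟨mem_univ _, mem_Ici.2 (le_max_right _ _)⟩
  have hset : MeasurableSet {y : Plane | ‖x - y‖ < a * t} :=
    measurableSet_lt (by fun_prop) (by fun_prop)
  have hset2 : MeasurableSet {p : Plane × ℝ | 0 < p.2 ∧ p.2 ≤ t - ‖x - p.1‖ / a} :=
    (measurableSet_lt measurable_const measurable_snd).inter
      (measurableSet_le measurable_snd (by fun_prop))
  have hm : Measurable fun p : Plane × ℝ => indicator {p | 0 < p.2 ∧ p.2 ≤ t - ‖x - p.1‖ / a}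
      (fun p => σ p.1 (max p.2 0) / √(a ^ 2 * (t - p.2) ^ 2 - ‖p.1 - x‖ ^ 2)) p :=
    (hcont.measurable.div (by fun_prop)).indicator hset2
  have hint := (hm.stronglyMeasurable.integral_prod_right' (ν := volume)).measurable.const_mul
    (1 / (2 * Real.pi * a))
  refine (congrArg Measurable (funext fun y => ?_)).mpr (hint.indicator hset)
  rw [waveKernel, indicator_apply]
  change _ = if ‖x - y‖ < a * t then _ else _
  split_ifs with h
  · congr 1
    have hle : 0 ≤ t - ‖x - y‖ / a := by
      rw [sub_nonneg, div_le_iff₀ ha]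
      linarith
    rw [intervalIntegral.integral_of_le hle, ← integral_indicator measurableSet_Ioc]
    refine integral_congr_ae (Eventually.of_forall fun τ => ?_)
    by_cases hτ : τ ∈ Ioc 0 (t - ‖x - y‖ / a)
    · rw [indicator_of_mem hτ]
      refine Eq.trans ?_ (indicator_of_mem (a := (y, τ)) (by exact hτ) _).symm
      simp only [max_eq_left hτ.1.le]
    · rw [indicator_of_notMem hτ]
      exact (indicator_of_notMem (a := (y, τ)) (by exact hτ) _).symm
  · rfl

end Kernel

/-! ### Maximal inequality and convergence for sums of independent Gaussians -/

section GaussianSums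

variable {Ω : Type*} [MeasurableSpace Ω] {P : Measure Ω} {X : ℕ → Ω → ℝ} {w : ℕ → ℝ≥0}

theorem integrable_exp_of_map_eq_gaussianReal {Y : Ω → ℝ} (hm : Measurable Y) {m : ℝ} {v : ℝ≥0}
    (hY : P.map Y = gaussianReal m v) : Integrable (fun ω => Real.exp (Y ω)) P := by
  have h := integrable_exp_mul_gaussianReal (μ := m) (v := v) 1
  rw [← hY, integrable_map_measure (by fun_prop) hm.aemeasurable] at h
  simpa [Function.comp_def] using h

theorem integral_exp_of_map_eq_gaussianReal {Y : Ω → ℝ} {v : ℝ≥0}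
    (hY : P.map Y = gaussianReal 0 v) : ∫ ω, Real.exp (Y ω) ∂P = Real.exp (v / 2) := by
  have h := mgf_gaussianReal hY 1
  simpa [mgf] using h

theorem map_sum_range_eq_gaussianReal [IsProbabilityMeasure P] (hm : ∀ k, Measurable (X k))
    (hi : iIndepFun X P) (hX : ∀ k, P.map (X k) = gaussianReal 0 (w k)) (n : ℕ) :
    P.map (fun ω => ∑ k ∈ Finset.range n, X k ω) =
      gaussianReal 0 (∑ k ∈ Finset.range n, w k) := by
  induction n with
  | zero => simp
  | succ n ih =>
    have hind : IndepFun (fun ω => ∑ k ∈ Finset.range n, X k ω) (X n) P := by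
      have := hi.indepFun_finsetSum_of_notMem hm (Finset.notMem_range_self (n := n))
      convert this using 1
      ext ω
      simp
    have := gaussianReal_add_gaussianReal_of_indepFun hind ih (hX n)
    rw [add_zero] at this
    rw [Finset.sum_range_succ, ← this]
    congr 1
    ext ω
    simp [Finset.sum_range_succ]

theorem stronglyAdapted_sum_range_natural (hm : ∀ k, Measurable (X k)) :
    StronglyAdapted (Filtration.natural X fun k => (hm k).stronglyMeasurable)
      fun n ω => ∑ k ∈ Finset.range (n + 1), X k ω := by
  intro n
  have : ∀ k ∈ Finset.range (n + 1), StronglyMeasurable[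
      Filtration.natural X (fun k => (hm k).stronglyMeasurable) n] (X k) := fun k hk =>
    (Filtration.stronglyAdapted_natural fun k => (hm k).stronglyMeasurable).stronglyMeasurable_le
      (Nat.lt_succ_iff.1 (Finset.mem_range.1 hk))
  exact Finset.stronglyMeasurable_fun_sum _ this

/-- By independence, one more summand multiplies the conditional expectation by `exp (w/2) ≥ 1`. -/
theorem submartingale_exp_sum_range [IsProbabilityMeasure P] (hm : ∀ k, Measurable (X k))
    (hi : iIndepFun X P) (hX : ∀ k, P.map (X k) = gaussianReal 0 (w k)) :
    Submartingale (fun n ω => Real.exp (∑ k ∈ Finset.range (n + 1), X k ω))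
      (Filtration.natural X fun k => (hm k).stronglyMeasurable) P := by
  have hint : ∀ n, Integrable (fun ω => Real.exp (∑ k ∈ Finset.range n, X k ω)) P := fun n =>
    integrable_exp_of_map_eq_gaussianReal (by fun_prop) (map_sum_range_eq_gaussianReal hm hi hX n)
  have had : StronglyAdapted (Filtration.natural X fun k => (hm k).stronglyMeasurable)
      fun n ω => Real.exp (∑ k ∈ Finset.range (n + 1), X k ω) := fun n =>
    Real.continuous_exp.comp_stronglyMeasurable (stronglyAdapted_sum_range_natural hm n)
  refine submartingale_nat had (fun n => hint _) fun n => ?_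
  set 𝒢 := Filtration.natural X fun k => (hm k).stronglyMeasurable
  have hXint : Integrable (fun ω => Real.exp (X (n + 1) ω)) P :=
    integrable_exp_of_map_eq_gaussianReal (hm _) (hX _)
  have hprod : (fun ω => Real.exp (∑ k ∈ Finset.range (n + 1 + 1), X k ω)) =
      (fun ω => Real.exp (∑ k ∈ Finset.range (n + 1), X k ω)) *
        fun ω => Real.exp (X (n + 1) ω) := by
    ext ω
    rw [Finset.sum_range_succ, Real.exp_add, Pi.mul_apply]
  have hpull := condExp_mul_of_stronglyMeasurable_left (μ := P) (had n)
    (by rw [← hprod]; exact hint _) hXint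
  have hcond : P[fun ω => Real.exp (X (n + 1) ω) | 𝒢 n] =ᵐ[P]
      fun _ => ∫ ω, Real.exp (X (n + 1) ω) ∂P :=
    condExp_indep_eq (hm (n + 1)).comap_le (𝒢.le n)
      (Real.continuous_exp.comp_stronglyMeasurable (comap_measurable _).stronglyMeasurable)
      (hi.indep_comap_natural_of_lt (fun k => (hm k).stronglyMeasurable) (Nat.lt_succ_self n))
  rw [hprod]
  filter_upwards [hpull, hcond] with ω h1 h2
  rw [h1, Pi.mul_apply, h2, integral_exp_of_map_eq_gaussianReal (hX _)]
  exact le_mul_of_one_le_right (Real.exp_pos _).le (Real.one_le_exp (by positivity))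

theorem martingale_sum_range [IsProbabilityMeasure P] (hm : ∀ k, Measurable (X k))
    (hi : iIndepFun X P) (hX : ∀ k, P.map (X k) = gaussianReal 0 (w k)) :
    Martingale (fun n ω => ∑ k ∈ Finset.range (n + 1), X k ω)
      (Filtration.natural X fun k => (hm k).stronglyMeasurable) P := by
  have hXint : ∀ k, Integrable (X k) P := fun k => by
    have h := (memLp_id_gaussianReal (μ := 0) (v := w k) 1).integrable le_rfl
    rw [← hX, integrable_map_measure (by fun_prop) (hm k).aemeasurable] at h
    exact h
  have hmean : ∀ k, ∫ ω, X k ω ∂P = 0 := fun k => by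
    have h := integral_id_gaussianReal (μ := 0) (v := w k)
    rwa [← hX, integral_map (hm k).aemeasurable (by fun_prop)] at h
  have had := stronglyAdapted_sum_range_natural hm
  have hint : ∀ n, Integrable (fun ω => ∑ k ∈ Finset.range n, X k ω) P := fun n =>
    integrable_finsetSum _ fun k _ => hXint k
  refine martingale_nat had (fun n => hint _) fun n => ?_
  set 𝒢 := Filtration.natural X fun k => (hm k).stronglyMeasurable
  have hsum : (fun ω => ∑ k ∈ Finset.range (n + 1 + 1), X k ω) =
      (fun ω => ∑ k ∈ Finset.range (n + 1), X k ω) + X (n + 1) := by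
    ext ω
    rw [Finset.sum_range_succ, Pi.add_apply]
  have hadd := condExp_add (hint (n + 1)) (hXint (n + 1)) (𝒢 n)
  have hcond := hi.condExp_natural_ae_eq_of_lt (fun k => (hm k).stronglyMeasurable)
    (Nat.lt_succ_self n)
  rw [hsum]
  filter_upwards [hadd, hcond] with ω h1 h2
  rw [h1, Pi.add_apply, h2, hmean, add_zero,
    condExp_of_stronglyMeasurable (𝒢.le n) (had n) (hint (n + 1))]

/-- Doob's maximal inequality for the exponential submartingale, whose mean is at most `exp (1/2)`
when the total variance is at most one. No optimization of the exponent is needed, since an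
exponential tail is enough later. -/
theorem measure_exists_le_sum_range_le [IsProbabilityMeasure P] (hm : ∀ k, Measurable (X k))
    (hi : iIndepFun X P) (hX : ∀ k, P.map (X k) = gaussianReal 0 (w k))
    (hw : ∀ n, ∑ k ∈ Finset.range n, w k ≤ 1) (u : ℝ) :
    P {ω | ∃ n, u ≤ ∑ k ∈ Finset.range (n + 1), X k ω} ≤ ENNReal.ofReal (Real.exp (1 / 2 - u)) := by
  have hsub := submartingale_exp_sum_range hm hi hX
  have hmono : Monotone fun N : ℕ => {ω | ∃ n ≤ N, u ≤ ∑ k ∈ Finset.range (n + 1), X k ω} :=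
    fun N N' h ω ⟨n, hn, hu⟩ => ⟨n, hn.trans h, hu⟩
  have hU : {ω | ∃ n, u ≤ ∑ k ∈ Finset.range (n + 1), X k ω} =
      ⋃ N : ℕ, {ω | ∃ n ≤ N, u ≤ ∑ k ∈ Finset.range (n + 1), X k ω} := by
    ext ω
    simp only [mem_ofPred_eq, mem_iUnion]
    exact ⟨fun ⟨n, h⟩ => ⟨n, n, le_rfl, h⟩, fun ⟨_, n, _, h⟩ => ⟨n, h⟩⟩
  rw [hU, hmono.measure_iUnion]
  refine iSup_le fun N => ?_
  have hmax := maximal_ineq hsub (fun n ω => (Real.exp_pos _).le)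
    (ε := (Real.exp u).toNNReal) N
  rw [Real.coe_toNNReal _ (Real.exp_pos u).le] at hmax
  have hset : {ω | ∃ n ≤ N, u ≤ ∑ k ∈ Finset.range (n + 1), X k ω} =
      {ω | Real.exp u ≤ (Finset.range (N + 1)).sup' Finset.nonempty_range_add_one
        fun n => Real.exp (∑ k ∈ Finset.range (n + 1), X k ω)} := by
    ext ω
    simp only [mem_ofPred_eq, Finset.le_sup'_iff, Finset.mem_range, Nat.lt_succ_iff, Real.exp_le_exp]
  rw [← hset] at hmax
  have hbound : ∫ ω in {ω | ∃ n ≤ N, u ≤ ∑ k ∈ Finset.range (n + 1), X k ω},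
      Real.exp (∑ k ∈ Finset.range (N + 1), X k ω) ∂P ≤ Real.exp (1 / 2) := by
    refine (setIntegral_le_integral (hsub.integrable N)
      (Eventually.of_forall fun ω => (Real.exp_pos _).le)).trans ?_
    rw [integral_exp_of_map_eq_gaussianReal (map_sum_range_eq_gaussianReal hm hi hX (N + 1))]
    have : ((∑ k ∈ Finset.range (N + 1), w k : ℝ≥0) : ℝ) ≤ 1 := by exact_mod_cast hw (N + 1)
    gcongr
  have h2 := hmax.trans (ENNReal.ofReal_le_ofReal hbound)
  rw [Real.exp_sub, ENNReal.ofReal_div_of_pos (Real.exp_pos u),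
    ENNReal.le_div_iff_mul_le (by simp [Real.exp_pos]) (by simp), mul_comm]
  exact h2

theorem measure_exists_le_abs_sum_range_le [IsProbabilityMeasure P] (hm : ∀ k, Measurable (X k))
    (hi : iIndepFun X P) (hX : ∀ k, P.map (X k) = gaussianReal 0 (w k))
    (hw : ∀ n, ∑ k ∈ Finset.range n, w k ≤ 1) (u : ℝ) :
    P {ω | ∃ n, u ≤ |∑ k ∈ Finset.range (n + 1), X k ω|} ≤
      ENNReal.ofReal (2 * Real.exp (1 / 2 - u)) := by
  have hneg : ∀ k, P.map (fun ω => -X k ω) = gaussianReal 0 (w k) := fun k => by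
    have := gaussianReal_neg ⟨(hm k).aemeasurable, hX k⟩
    have h := this.map_eq
    rw [neg_zero] at h
    exact h
  have h1 := measure_exists_le_sum_range_le hm hi hX hw u
  have h2 := measure_exists_le_sum_range_le (fun k => (hm k).neg)
    (hi.comp (fun _ x => -x) fun _ => measurable_neg) hneg hw u
  have hsub : {ω | ∃ n, u ≤ |∑ k ∈ Finset.range (n + 1), X k ω|} ⊆
      {ω | ∃ n, u ≤ ∑ k ∈ Finset.range (n + 1), X k ω} ∪
        {ω | ∃ n, u ≤ ∑ k ∈ Finset.range (n + 1), (-X k) ω} := by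
    rintro ω ⟨n, hn⟩
    rcases le_abs.1 hn with h | h
    · exact Or.inl ⟨n, h⟩
    · refine Or.inr ⟨n, ?_⟩
      simpa using h
  refine (measure_mono hsub).trans ((measure_union_le _ _).trans ((add_le_add h1 h2).trans ?_))
  rw [← ENNReal.ofReal_add (Real.exp_pos _).le (Real.exp_pos _).le, two_mul]

/-- The partial sums form a martingale, bounded in `L¹` through `|S| ≤ exp S + exp (-S)`; martingale
convergence applies. -/
theorem ae_exists_tendsto_sum_range [IsProbabilityMeasure P] (hm : ∀ k, Measurable (X k))
    (hi : iIndepFun X P) (hX : ∀ k, P.map (X k) = gaussianReal 0 (w k)) {V : ℝ≥0}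
    (hw : ∀ n, ∑ k ∈ Finset.range n, w k ≤ V) :
    ∀ᵐ ω ∂P, ∃ l, Tendsto (fun n => ∑ k ∈ Finset.range n, X k ω) atTop (𝓝 l) := by
  have hmart := (martingale_sum_range hm hi hX).submartingale
  have hbdd : ∀ n, eLpNorm (fun ω => ∑ k ∈ Finset.range (n + 1), X k ω) 1 P ≤
      (2 * Real.exp (V / 2)).toNNReal := by
    intro n
    set S := fun ω => ∑ k ∈ Finset.range (n + 1), X k ω
    have hS := map_sum_range_eq_gaussianReal hm hi hX (n + 1)
    have hSm : Measurable S := by fun_prop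
    have hSn : P.map (fun ω => -S ω) = gaussianReal 0 (∑ k ∈ Finset.range (n + 1), w k) := by
      have := gaussianReal_neg ⟨hSm.aemeasurable, hS⟩
      have h := this.map_eq
      rw [neg_zero] at h
      exact h
    have hle : ((∑ k ∈ Finset.range (n + 1), w k : ℝ≥0) : ℝ) ≤ V := by exact_mod_cast hw (n + 1)
    rw [eLpNorm_one_eq_lintegral_enorm]
    have hint1 := integrable_exp_of_map_eq_gaussianReal hSm hS
    have hint2 : Integrable (fun ω => Real.exp (-S ω)) P :=
      integrable_exp_of_map_eq_gaussianReal hSm.neg hSn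
    calc ∫⁻ ω, ‖S ω‖ₑ ∂P ≤ ∫⁻ ω, ENNReal.ofReal (Real.exp (S ω) + Real.exp (-S ω)) ∂P := by
          refine lintegral_mono fun ω => ?_
          rw [← ofReal_norm, Real.norm_eq_abs]
          refine ENNReal.ofReal_le_ofReal (abs_le'.2 ⟨?_, ?_⟩)
          · linarith [Real.add_one_le_exp (S ω), Real.exp_pos (-S ω)]
          · linarith [Real.add_one_le_exp (-S ω), Real.exp_pos (S ω)]
      _ = ENNReal.ofReal (∫ ω, Real.exp (S ω) + Real.exp (-S ω) ∂P) :=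
          (ofReal_integral_eq_lintegral_ofReal (hint1.add hint2)
            (Eventually.of_forall fun ω => (add_pos (Real.exp_pos _) (Real.exp_pos _)).le)).symm
      _ ≤ _ := by
          rw [integral_add hint1 hint2, integral_exp_of_map_eq_gaussianReal hS,
            integral_exp_of_map_eq_gaussianReal hSn, ← two_mul]
          refine ENNReal.ofReal_le_ofReal ?_
          gcongr
  filter_upwards [hmart.ae_tendsto_limitProcess hbdd] with ω hω
  exact ⟨_, (tendsto_add_atTop_iff_nat 1).1 hω⟩

end GaussianSums

/-! ### Weighted sums with a common variance -/

section WeightedSums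

variable {Ω : Type*} [MeasurableSpace Ω] {P : Measure Ω}
  {g : ℕ → Ω → ℝ} {v : ℝ≥0} {a : ℕ → ℝ}

theorem map_const_mul_eq_gaussianReal {Y : Ω → ℝ} (hm : Measurable Y)
    (hY : P.map Y = gaussianReal 0 v) (c : ℝ) :
    P.map (fun ω => c * Y ω) = gaussianReal 0 ((c ^ 2).toNNReal * v) := by
  have := (gaussianReal_const_mul ⟨hm.aemeasurable, hY⟩ c).map_eq
  rw [mul_zero] at this
  rw [this, Real.toNNReal_of_nonneg (sq_nonneg c)]

theorem measure_exists_le_abs_weighted_sum_le [IsProbabilityMeasure P] (hm : ∀ k, Measurable (g k)) (hi : iIndepFun g P)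
    (hg : ∀ k, P.map (g k) = gaussianReal 0 v) {B : ℝ} (hB : 0 < B)
    (ha : ∀ n, v * ∑ k ∈ Finset.range n, a k ^ 2 ≤ B ^ 2) (u : ℝ) :
    P {ω | ∃ n, B * u ≤ |∑ k ∈ Finset.range (n + 1), a k * g k ω|} ≤
      ENNReal.ofReal (2 * Real.exp (1 / 2 - u)) := by
  have h := measure_exists_le_abs_sum_range_le (P := P) (X := fun k ω => a k / B * g k ω)
    (fun k => (hm k).const_mul _)
    (hi.comp (fun k x => a k / B * x) fun k => measurable_const_mul _)
    (fun k => map_const_mul_eq_gaussianReal (hm k) (hg k) (a k / B)) (fun n => ?_) u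
  · convert! h using 6 with ω n
    have : ∑ k ∈ Finset.range (n + 1), a k / B * g k ω =
        (∑ k ∈ Finset.range (n + 1), a k * g k ω) / B := by
      rw [Finset.sum_div]
      exact Finset.sum_congr rfl fun k _ => by ring
    rw [this, abs_div, abs_of_pos hB, le_div_iff₀ hB, mul_comm]
  · rw [← NNReal.coe_le_coe]
    push_cast
    have hcoe : ∀ i, (((a i / B) ^ 2).toNNReal : ℝ) = a i ^ 2 / B ^ 2 := fun i => by
      rw [Real.coe_toNNReal _ (sq_nonneg _), div_pow]
    simp only [hcoe]
    rw [← Finset.sum_mul, ← Finset.sum_div, div_mul_eq_mul_div, div_le_one (by positivity), mul_comm]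
    exact ha n

theorem ae_exists_tendsto_weighted_sum [IsProbabilityMeasure P] (hm : ∀ k, Measurable (g k)) (hi : iIndepFun g P)
    (hg : ∀ k, P.map (g k) = gaussianReal 0 v) {B : ℝ}
    (ha : ∀ n, ∑ k ∈ Finset.range n, a k ^ 2 ≤ B) :
    ∀ᵐ ω ∂P, ∃ l, Tendsto (fun n => ∑ k ∈ Finset.range n, a k * g k ω) atTop (𝓝 l) := by
  refine ae_exists_tendsto_sum_range (P := P) (X := fun k ω => a k * g k ω)
    (V := B.toNNReal * v) (fun k => (hm k).const_mul _)
    (hi.comp (fun k x => a k * x) fun k => measurable_const_mul _)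
    (fun k => map_const_mul_eq_gaussianReal (hm k) (hg k) (a k)) fun n => ?_
  have hB : 0 ≤ B := (Finset.sum_nonneg fun k _ => sq_nonneg (a k)).trans (ha n)
  rw [← NNReal.coe_le_coe]
  push_cast
  simp only [Real.coe_toNNReal _ (sq_nonneg _), Real.coe_toNNReal _ hB]
  rw [← Finset.sum_mul]
  exact mul_le_mul_of_nonneg_right (ha n) v.2

end WeightedSums

/-! ### Dyadic chaining -/

section Chaining

variable {f : ℝ → ℝ} {q A : ℝ}

/-- The largest dyadic number of level `m` which does not exceed `s`. -/
noncomputable def dyadicFloor (m : ℕ) (s : ℝ) : ℝ := ⌊s * 2 ^ m⌋₊ / 2 ^ m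

theorem natFloor_mul_two_pow_le {s : ℝ} (hs : s ≤ 1) (m : ℕ) : ⌊s * 2 ^ m⌋₊ ≤ 2 ^ m := by
  refine Nat.floor_le_of_le ?_
  push_cast
  exact mul_le_of_le_one_left (by positivity) hs

theorem dyadicFloor_mem_Icc {s : ℝ} (hs : s ∈ Icc (0 : ℝ) 1) (m : ℕ) :
    dyadicFloor m s ∈ Icc (0 : ℝ) 1 := by
  refine ⟨by unfold dyadicFloor; positivity, ?_⟩
  rw [dyadicFloor, div_le_one (by positivity)]
  exact_mod_cast natFloor_mul_two_pow_le hs.2 m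

theorem tendsto_dyadicFloor {s : ℝ} (hs : 0 ≤ s) :
    Tendsto (fun m => dyadicFloor m s) atTop (𝓝 s) :=
  (tendsto_nat_floor_mul_div_atTop hs).comp (tendsto_pow_atTop_atTop_of_one_lt one_lt_two)

/-- If all dyadic increments of level `m` are bounded by `w`, so is the increment between two
dyadic points of level `m` with adjacent indices. -/
theorem abs_sub_le_of_dyadic {m i j : ℕ} {w : ℝ} (hw : 0 ≤ w)
    (hf : ∀ i : ℕ, i < 2 ^ m → |f ((i + 1) / 2 ^ m) - f (i / 2 ^ m)| ≤ w)
    (hij : i ≤ j) (hji : j ≤ i + 1) (hj : j ≤ 2 ^ m) :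
    |f (j / 2 ^ m) - f (i / 2 ^ m)| ≤ w := by
  obtain rfl | rfl : j = i ∨ j = i + 1 := by omega
  · simpa using hw
  · have := hf i (Nat.lt_of_succ_le hj)
    push_cast
    exact this

/-- Refining the grid moves the dyadic floor by zero or one cell of the finer level. -/
theorem abs_dyadicFloor_succ_sub_le {m : ℕ} {w s : ℝ} (hs : s ∈ Icc (0 : ℝ) 1) (hw : 0 ≤ w)
    (hf : ∀ i : ℕ, i < 2 ^ (m + 1) → |f ((i + 1) / 2 ^ (m + 1)) - f (i / 2 ^ (m + 1))| ≤ w) :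
    |f (dyadicFloor (m + 1) s) - f (dyadicFloor m s)| ≤ w := by
  have hx : 0 ≤ s * 2 ^ m := mul_nonneg hs.1 (by positivity)
  have h1 : 2 * ⌊s * 2 ^ m⌋₊ ≤ ⌊s * 2 ^ (m + 1)⌋₊ := by
    refine Nat.le_floor ?_
    push_cast
    have := Nat.floor_le hx
    rw [pow_succ]
    linarith
  have h2 : ⌊s * 2 ^ (m + 1)⌋₊ ≤ 2 * ⌊s * 2 ^ m⌋₊ + 1 := by
    refine Nat.lt_succ_iff.1 ((Nat.floor_lt (mul_nonneg hs.1 (by positivity))).2 ?_)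
    push_cast
    have := Nat.lt_floor_add_one (s * 2 ^ m)
    rw [pow_succ]
    linarith
  have h := abs_sub_le_of_dyadic hw hf h1 h2 (natFloor_mul_two_pow_le hs.2 _)
  have e : ((2 * ⌊s * 2 ^ m⌋₊ : ℕ) : ℝ) / 2 ^ (m + 1) = dyadicFloor m s := by
    rw [dyadicFloor]
    push_cast
    rw [pow_succ, mul_comm (2 ^ m : ℝ) 2, mul_div_mul_left _ _ two_ne_zero]
  rwa [e] at h

theorem abs_dyadicFloor_sub_le {m : ℕ} {w s t : ℝ} (hs : s ∈ Icc (0 : ℝ) 1)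
    (ht : t ∈ Icc (0 : ℝ) 1) (hst : s ≤ t) (hts : t - s ≤ 1 / 2 ^ m) (hw : 0 ≤ w)
    (hf : ∀ i : ℕ, i < 2 ^ m → |f ((i + 1) / 2 ^ m) - f (i / 2 ^ m)| ≤ w) :
    |f (dyadicFloor m t) - f (dyadicFloor m s)| ≤ w := by
  refine abs_sub_le_of_dyadic hw hf ?_ ?_ (natFloor_mul_two_pow_le ht.2 _)
  · exact Nat.floor_mono (by gcongr)
  · rw [← Nat.floor_add_one (mul_nonneg hs.1 (by positivity))]
    refine Nat.floor_mono ?_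
    rw [le_div_iff₀ (by positivity)] at hts
    linarith

theorem summable_succ_mul_pow (hq0 : 0 ≤ q) (hq1 : q < 1) :
    Summable fun i : ℕ => ((i : ℝ) + 1) * q ^ i := by
  have h1 := summable_pow_mul_geometric_of_norm_lt_one (R := ℝ) 1
    (by rwa [Real.norm_of_nonneg hq0] : ‖q‖ < 1)
  have h2 := summable_geometric_of_lt_one hq0 hq1
  refine (h1.add h2).congr fun i => ?_
  rw [pow_one]
  ring

theorem abs_sub_dyadicFloor_le (hq0 : 0 ≤ q) (hq1 : q < 1) (hA : 0 ≤ A)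
    (hc : ContinuousOn f (Icc 0 1))
    (hf : ∀ m : ℕ, ∀ i : ℕ, i < 2 ^ m → |f ((i + 1) / 2 ^ m) - f (i / 2 ^ m)| ≤ A * ((m + 1) * q ^ m))
    (n : ℕ) {s : ℝ} (hs : s ∈ Icc (0 : ℝ) 1) :
    |f s - f (dyadicFloor n s)| ≤ (∑' i : ℕ, ((i : ℝ) + 1) * q ^ i) * (A * ((n + 1) * q ^ n)) := by
  set K := ∑' i : ℕ, ((i : ℝ) + 1) * q ^ i
  have hsum := summable_succ_mul_pow hq0 hq1
  have hpos : ∀ i : ℕ, 0 ≤ ((i : ℝ) + 1) * q ^ i := fun i => by positivity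
  have hstep : ∀ j : ℕ, |f (dyadicFloor (n + j) s) - f (dyadicFloor n s)| ≤
      (∑ i ∈ Finset.range j, ((i + 1 : ℕ) + 1 : ℝ) * q ^ (i + 1)) * (A * ((n + 1) * q ^ n)) := by
    intro j
    induction j with
    | zero => simp
    | succ j ih =>
      have h := abs_dyadicFloor_succ_sub_le (m := n + j) hs (by positivity) (hf (n + j + 1))
      -- From `n + j + 2 ≤ (j + 2)(n + 1)`: the increments beyond level `n` are a summable sequence
      -- times the bound at level `n`.
      have hle : A * (((n + j + 1 : ℕ) + 1) * q ^ (n + j + 1)) ≤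
          ((j + 1 : ℕ) + 1 : ℝ) * q ^ (j + 1) * (A * ((n + 1) * q ^ n)) := by
        have e : ((j + 1 : ℕ) + 1 : ℝ) * q ^ (j + 1) * (A * ((n + 1) * q ^ n)) =
            A * ((((j + 1 : ℕ) + 1 : ℝ) * (n + 1)) * q ^ (n + j + 1)) := by ring
        rw [e]
        gcongr
        push_cast
        nlinarith [Nat.cast_nonneg (α := ℝ) n, Nat.cast_nonneg (α := ℝ) j,
          mul_nonneg (Nat.cast_nonneg (α := ℝ) n) (Nat.cast_nonneg (α := ℝ) j)]
      rw [Finset.sum_range_succ, add_mul]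
      have htri := abs_sub_le (f (dyadicFloor (n + (j + 1)) s)) (f (dyadicFloor (n + j) s))
        (f (dyadicFloor n s))
      rw [← add_assoc] at htri ⊢
      linarith
  have hK : ∀ j : ℕ, ∑ i ∈ Finset.range j, ((i + 1 : ℕ) + 1 : ℝ) * q ^ (i + 1) ≤ K := by
    intro j
    have h1 := hsum.sum_le_tsum (Finset.range (j + 1)) fun i _ => hpos i
    rw [Finset.sum_range_succ'] at h1
    linarith [hpos 0]
  have hlim : Tendsto (fun j => |f (dyadicFloor (n + j) s) - f (dyadicFloor n s)|) atTop
      (𝓝 |f s - f (dyadicFloor n s)|) := by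
    have h1 : Tendsto (fun j => dyadicFloor (n + j) s) atTop (𝓝[Icc 0 1] s) := by
      refine tendsto_nhdsWithin_iff.2 ⟨?_, Eventually.of_forall fun j => dyadicFloor_mem_Icc hs _⟩
      simp only [add_comm n]
      exact (tendsto_add_atTop_iff_nat n).2 (tendsto_dyadicFloor hs.1)
    exact (((hc s hs).tendsto.comp h1).sub_const _).abs
  refine le_of_tendsto' hlim fun j => (hstep j).trans ?_
  exact mul_le_mul_of_nonneg_right (hK j) (by positivity)

theorem abs_sub_le_of_abs_sub_le_two_pow (hq0 : 0 ≤ q) (hq1 : q < 1) (hA : 0 ≤ A)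
    (hc : ContinuousOn f (Icc 0 1))
    (hf : ∀ m : ℕ, ∀ i : ℕ, i < 2 ^ m → |f ((i + 1) / 2 ^ m) - f (i / 2 ^ m)| ≤ A * ((m + 1) * q ^ m))
    (n : ℕ) {s t : ℝ} (hs : s ∈ Icc (0 : ℝ) 1) (ht : t ∈ Icc (0 : ℝ) 1) (hst : s ≤ t)
    (hts : t - s ≤ 1 / 2 ^ n) :
    |f t - f s| ≤ (2 * (∑' i : ℕ, ((i : ℝ) + 1) * q ^ i) + 1) * (A * ((n + 1) * q ^ n)) := by
  have h1 := abs_sub_dyadicFloor_le hq0 hq1 hA hc hf n hs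
  have h2 := abs_sub_dyadicFloor_le hq0 hq1 hA hc hf n ht
  have h3 := abs_dyadicFloor_sub_le hs ht hst hts (by positivity) (hf n)
  rw [abs_sub_comm] at h1
  have h4 := abs_sub_le (f t) (f (dyadicFloor n t)) (f s)
  have h5 := abs_sub_le (f (dyadicFloor n t)) (f (dyadicFloor n s)) (f s)
  linarith

/-- A continuous function whose dyadic increments of level `m` are `O((m + 1) 2 ^ (- β m))` has
modulus of continuity `O(h ^ β (1 + |log h|))`. -/
theorem exists_abs_sub_le_rpow_mul_log {β : ℝ} (hβ : 0 < β) : ∃ K : ℝ, 0 ≤ K ∧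
    ∀ (f : ℝ → ℝ) (A : ℝ), 0 ≤ A → ContinuousOn f (Icc 0 1) →
      (∀ m : ℕ, ∀ i : ℕ, i < 2 ^ m → |f ((i + 1) / 2 ^ m) - f (i / 2 ^ m)| ≤
        A * ((m + 1) * ((2 : ℝ) ^ (-β)) ^ m)) →
      ∀ s ∈ Icc (0 : ℝ) 1, ∀ t ∈ Icc (0 : ℝ) 1, 0 < |t - s| →
        |f t - f s| ≤ K * A * (|t - s| ^ β * (1 + abs (Real.log |t - s|))) := by
  set q : ℝ := (2 : ℝ) ^ (-β) with hq
  have hq0 : 0 ≤ q := by positivity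
  have hq1 : q < 1 := Real.rpow_lt_one_of_one_lt_of_neg one_lt_two (by linarith)
  set S := ∑' i : ℕ, ((i : ℝ) + 1) * q ^ i
  have hS : 0 ≤ S := tsum_nonneg fun i => by positivity
  have hl2 : 0 < Real.log 2 := Real.log_pos one_lt_two
  have hl2' : Real.log 2 < 1 := by linarith [Real.log_two_lt_d9]
  -- `2 * S + 1` counts the two chains and the step joining them, `2 ^ β` pays for rounding the
  -- distance to a power of two, and `(Real.log 2)⁻¹` converts the level into a logarithm. Nothing
  -- depends on `f`, so one constant serves all partial sums.
  refine ⟨(2 * S + 1) * (2 ^ β * (Real.log 2)⁻¹), by positivity, fun f A hA hc hf => ?_⟩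
  have key : ∀ s ∈ Icc (0 : ℝ) 1, ∀ t ∈ Icc (0 : ℝ) 1, s < t →
      |f t - f s| ≤ (2 * S + 1) * (2 ^ β * (Real.log 2)⁻¹) * A *
        ((t - s) ^ β * (1 + |Real.log (t - s)|)) := by
    intro s hs t ht hst
    have hd : 0 < t - s := sub_pos.2 hst
    have hd1 : t - s ≤ 1 := by linarith [hs.1, ht.2]
    obtain ⟨n, hn1, hn2⟩ := exists_nat_pow_near_of_lt_one hd hd1 (by norm_num : (0 : ℝ) < 1 / 2)
      (by norm_num)
    have h := abs_sub_le_of_abs_sub_le_two_pow hq0 hq1 hA hc hf n hs ht hst.le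
      (by rwa [one_div_pow] at hn2)
    have hqn : q ^ n ≤ 2 ^ β * (t - s) ^ β := by
      have e : q ^ n = 2 ^ β * ((1 / 2 : ℝ) ^ (n + 1)) ^ β := by
        rw [hq, ← Real.rpow_natCast, ← Real.rpow_mul (by norm_num), ← Real.rpow_natCast (1 / 2),
          one_div, ← Real.rpow_neg_one, ← Real.rpow_mul (by norm_num),
          ← Real.rpow_mul (by norm_num), ← Real.rpow_add (by norm_num)]
        congr 1
        push_cast
        ring
      rw [e]
      gcongr
    have hlog : (n : ℝ) + 1 ≤ (Real.log 2)⁻¹ * (1 + |Real.log (t - s)|) := by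
      have h1 : Real.log (t - s) ≤ n * Real.log (1 / 2) := by
        rw [← Real.log_pow]
        exact Real.log_le_log hd hn2
      rw [one_div, Real.log_inv] at h1
      have h2 : n * Real.log 2 ≤ |Real.log (t - s)| := by
        refine le_trans ?_ (neg_le_abs _)
        linarith
      rw [inv_mul_eq_div, le_div_iff₀ hl2]
      linarith
    calc |f t - f s| ≤ (2 * S + 1) * (A * ((n + 1) * q ^ n)) := h
      _ ≤ (2 * S + 1) * (A * (((Real.log 2)⁻¹ * (1 + |Real.log (t - s)|)) *
          (2 ^ β * (t - s) ^ β))) := by gcongr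
      _ = _ := by ring
  intro s hs t ht hpos
  rcases lt_trichotomy s t with h | h | h
  · rw [abs_of_pos (sub_pos.2 h)]
    exact key s hs t ht h
  · simp [h] at hpos
  · rw [abs_sub_comm (f t), abs_sub_comm t, abs_of_pos (sub_pos.2 h)]
    exact key t ht s hs h

/-- A three-epsilon argument: the chaining bound is uniform in `N`, so `t` may be replaced by a
fixed dyadic floor, where the sequence is Cauchy. -/
theorem exists_tendsto_of_dyadic {S : ℕ → ℝ → ℝ} (hq0 : 0 ≤ q) (hq1 : q < 1) (hA : 0 ≤ A)
    (hc : ∀ N, ContinuousOn (S N) (Icc 0 1))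
    (hf : ∀ N, ∀ m : ℕ, ∀ i : ℕ, i < 2 ^ m → |S N ((i + 1) / 2 ^ m) - S N (i / 2 ^ m)| ≤
      A * ((m + 1) * q ^ m))
    (hlim : ∀ m i : ℕ, i ≤ 2 ^ m → ∃ l, Tendsto (fun N => S N (i / 2 ^ m)) atTop (𝓝 l))
    {t : ℝ} (ht : t ∈ Icc (0 : ℝ) 1) : ∃ l, Tendsto (fun N => S N t) atTop (𝓝 l) := by
  refine cauchySeq_tendsto_of_complete (Metric.cauchySeq_iff'.2 fun ε hε => ?_)
  set K := ∑' i : ℕ, ((i : ℝ) + 1) * q ^ i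
  have hzero : Tendsto (fun n : ℕ => K * (A * (((n : ℝ) + 1) * q ^ n))) atTop (𝓝 0) := by
    have := ((summable_succ_mul_pow hq0 hq1).tendsto_atTop_zero.const_mul A).const_mul K
    simpa using this
  obtain ⟨n, hn⟩ := (hzero.eventually (gt_mem_nhds (show 0 < ε / 3 by linarith))).exists
  obtain ⟨l, hl⟩ := hlim n _ (natFloor_mul_two_pow_le ht.2 n)
  obtain ⟨N, hN⟩ := Metric.cauchySeq_iff'.1 hl.cauchySeq (ε / 3) (by linarith)
  refine ⟨N, fun M hM => ?_⟩
  have h1 := abs_sub_dyadicFloor_le hq0 hq1 hA (hc M) (hf M) n ht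
  have h2 := abs_sub_dyadicFloor_le hq0 hq1 hA (hc N) (hf N) n ht
  have h3 := hN M hM
  rw [Real.dist_eq] at h3 ⊢
  change |S M (dyadicFloor n t) - S N (dyadicFloor n t)| < ε / 3 at h3
  rw [abs_sub_comm] at h2
  have h4 := abs_sub_le (S M t) (S M (dyadicFloor n t)) (S N t)
  have h5 := abs_sub_le (S M (dyadicFloor n t)) (S N (dyadicFloor n t)) (S N t)
  linarith

end Chaining

/-- The absolute increment of `f` over the `i`-th dyadic interval of level `m` of `[0, 1]`, divided
by `(m + 1) 2 ^ (- β m)`. -/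
noncomputable def dyadicRatio (β : ℝ) (f : ℝ → ℝ) (m i : ℕ) : ℝ :=
  if i < 2 ^ m then |f ((i + 1) / 2 ^ m) - f (i / 2 ^ m)| / ((m + 1) * ((2 : ℝ) ^ (-β)) ^ m) else 0

theorem dyadicRatio_nonneg (β : ℝ) (f : ℝ → ℝ) (m i : ℕ) : 0 ≤ dyadicRatio β f m i := by
  unfold dyadicRatio
  split_ifs <;> positivity

theorem succ_div_two_pow_mem_Icc {m i : ℕ} (h : i < 2 ^ m) :
    ((i : ℝ) + 1) / 2 ^ m ∈ Icc (0 : ℝ) 1 := by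
  refine ⟨by positivity, ?_⟩
  rw [div_le_one (by positivity)]
  exact_mod_cast h

theorem div_two_pow_mem_Icc {m i : ℕ} (h : i ≤ 2 ^ m) : (i : ℝ) / 2 ^ m ∈ Icc (0 : ℝ) 1 := by
  refine ⟨by positivity, ?_⟩
  rw [div_le_one (by positivity)]
  exact_mod_cast h

/-! ### Uniform dyadic increments of Gaussian series -/

section GaussianSeries

variable {Ω : Type*} [MeasurableSpace Ω] {P : Measure Ω} [IsProbabilityMeasure P]
  {g : ℕ → Ω → ℝ} {v : ℝ≥0} {F : ℕ → ℝ → ℝ} {c : ℕ → ℝ} {β R : ℝ}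

theorem sq_le_of_abs_sub_le (hF : ∀ k, ∀ s ∈ Icc (0 : ℝ) 1, ∀ t ∈ Icc (0 : ℝ) 1,
    |F k t - F k s| ≤ c k * |t - s| ^ β) {m i : ℕ} (hi : i < 2 ^ m) (k : ℕ) :
    (F k ((i + 1) / 2 ^ m) - F k (i / 2 ^ m)) ^ 2 ≤ c k ^ 2 * (((2 : ℝ) ^ (-β)) ^ m) ^ 2 := by
  have h := hF k _ (div_two_pow_mem_Icc hi.le) _ (succ_div_two_pow_mem_Icc hi)
  have e : |((i : ℝ) + 1) / 2 ^ m - i / 2 ^ m| ^ β = ((2 : ℝ) ^ (-β)) ^ m := by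
    rw [← sub_div, add_sub_cancel_left, abs_of_pos (by positivity), one_div, ← inv_pow,
      ← Real.rpow_natCast, ← Real.rpow_natCast, ← Real.rpow_mul (by norm_num),
      ← Real.rpow_neg_one, ← Real.rpow_mul (by norm_num), ← Real.rpow_mul (by norm_num)]
    congr 1
    ring
  rw [e] at h
  rw [← mul_pow, ← sq_abs]
  exact pow_le_pow_left₀ (abs_nonneg _) h 2

/-- The union bound over `2^m` intervals is summable against the tail at `m + 1` because `2 / e <
1`. -/
theorem tsum_two_pow_mul_exp_ne_top :
    ∑' m : ℕ, (2 : ENNReal) ^ m * ENNReal.ofReal (2 * Real.exp (1 / 2 - (m + 1))) ≠ ⊤ := by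
  have e : ∀ m : ℕ, (2 : ENNReal) ^ m * ENNReal.ofReal (2 * Real.exp (1 / 2 - (m + 1))) =
      ENNReal.ofReal ((2 * Real.exp (-1 / 2)) * (2 * Real.exp (-1)) ^ m) := by
    intro m
    have h2 : (2 : ENNReal) ^ m = ENNReal.ofReal (2 ^ m) := by
      rw [ENNReal.ofReal_pow (by norm_num)]
      norm_num
    rw [h2, ← ENNReal.ofReal_mul (by positivity)]
    congr 1
    rw [mul_pow, ← Real.exp_nat_mul,
      show (1 / 2 - ((m : ℝ) + 1)) = -1 / 2 + m * -1 by ring, Real.exp_add]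
    ring
  simp_rw [e]
  have hs : Summable fun m : ℕ => (2 * Real.exp (-1 / 2)) * (2 * Real.exp (-1)) ^ m := by
    refine (summable_geometric_of_lt_one (by positivity) ?_).mul_left _
    rw [Real.exp_neg, ← div_eq_mul_inv, div_lt_one (Real.exp_pos _)]
    linarith [Real.exp_one_gt_d9]
  exact hs.tsum_ofReal_ne_top

/-- Partial sums of a series of Hölder functions with independent Gaussian weights: if the Hölder
constants are square summable, the dyadic increments are controlled uniformly. -/
theorem ae_bddAbove_dyadicRatio (hm : ∀ k, Measurable (g k)) (hi : iIndepFun g P)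
    (hg : ∀ k, P.map (g k) = gaussianReal 0 v)
    (hF : ∀ k, ∀ s ∈ Icc (0 : ℝ) 1, ∀ t ∈ Icc (0 : ℝ) 1, |F k t - F k s| ≤ c k * |t - s| ^ β)
    (hF0 : ∀ k, F k 0 = 0) (hc : ∀ n, ∑ k ∈ Finset.range n, c k ^ 2 ≤ R) (hβ : 0 < β) :
    ∀ᵐ ω ∂P,
      BddAbove (range fun p : ℕ × ℕ × ℕ =>
        dyadicRatio β (fun t => ∑ k ∈ Finset.range p.1, F k t * g k ω) p.2.1 p.2.2) ∧
      ∀ m i : ℕ, i ≤ 2 ^ m →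
        ∃ l, Tendsto (fun N => ∑ k ∈ Finset.range N, F k (i / 2 ^ m) * g k ω) atTop (𝓝 l) := by
  have hR : 0 ≤ R := by simpa using hc 0
  have hconv : ∀ᵐ ω ∂P, ∀ m i : ℕ, i ≤ 2 ^ m →
      ∃ l, Tendsto (fun N => ∑ k ∈ Finset.range N, F k (i / 2 ^ m) * g k ω) atTop (𝓝 l) := by
    rw [ae_all_iff]
    intro m
    rw [ae_all_iff]
    intro i
    by_cases him : i ≤ 2 ^ m
    · have hmem := div_two_pow_mem_Icc him
      have h0 : (0 : ℝ) ∈ Icc (0 : ℝ) 1 := ⟨le_rfl, zero_le_one⟩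
      refine (ae_exists_tendsto_weighted_sum (a := fun k => F k (i / 2 ^ m)) hm hi hg
        (fun n => (Finset.sum_le_sum fun k _ => ?_).trans (hc n))).mono fun ω h _ => h
      have h := hF k 0 h0 _ hmem
      rw [hF0, sub_zero, sub_zero, abs_of_nonneg hmem.1] at h
      have h1 : ((i : ℝ) / 2 ^ m) ^ β ≤ 1 := Real.rpow_le_one hmem.1 hmem.2 hβ.le
      have hck : 0 ≤ c k := by
        have := (abs_nonneg _).trans (hF k 0 h0 1 ⟨zero_le_one, le_rfl⟩)
        simpa using this
      rw [← sq_abs]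
      exact pow_le_pow_left₀ (abs_nonneg _) (h.trans (mul_le_of_le_one_right hck h1)) 2
    · exact Eventually.of_forall fun ω h => absurd h him
  -- The summand one keeps `D` positive even when `v * R = 0`.
  set D := √(v * R + 1) with hD
  have hDpos : 0 < D := Real.sqrt_pos.2 (by positivity)
  set q : ℝ := (2 : ℝ) ^ (-β) with hq
  have hq0 : 0 < q := by positivity
  let bad : ℕ → ℕ → Set Ω := fun m i => {ω | ∃ n, D * q ^ m * (m + 1) ≤
    |∑ k ∈ Finset.range (n + 1), (F k ((i + 1) / 2 ^ m) - F k (i / 2 ^ m)) * g k ω|}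
  have hbad : ∀ m i, i < 2 ^ m →
      P (bad m i) ≤ ENNReal.ofReal (2 * Real.exp (1 / 2 - (m + 1))) := by
    intro m i him
    refine measure_exists_le_abs_weighted_sum_le hm hi hg (by positivity) (fun n => ?_) _
    calc (v : ℝ) * ∑ k ∈ Finset.range n, (F k ((i + 1) / 2 ^ m) - F k (i / 2 ^ m)) ^ 2
        ≤ v * ∑ k ∈ Finset.range n, c k ^ 2 * (q ^ m) ^ 2 := by
          gcongr with k hk
          exact sq_le_of_abs_sub_le hF him k
      _ = v * (∑ k ∈ Finset.range n, c k ^ 2) * (q ^ m) ^ 2 := by rw [← Finset.sum_mul, mul_assoc]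
      _ ≤ (v * R + 1) * (q ^ m) ^ 2 := by
          gcongr
          have := mul_le_mul_of_nonneg_left (hc n) v.2
          exact this.trans (le_add_of_nonneg_right zero_le_one)
      _ = (D * q ^ m) ^ 2 := by rw [mul_pow, hD, Real.sq_sqrt (by positivity)]
  have hBC : ∀ᵐ ω ∂P, {m : ℕ | ω ∈ ⋃ i ∈ Finset.range (2 ^ m), bad m i}.Finite := by
    refine ae_finite_setOfPred_mem (ne_top_of_le_ne_top tsum_two_pow_mul_exp_ne_top
      (ENNReal.tsum_le_tsum fun m => ?_))
    refine (measure_biUnion_finset_le _ _).trans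
      ((Finset.sum_le_sum fun i hi' => hbad m i (Finset.mem_range.1 hi')).trans ?_)
    rw [Finset.sum_const, Finset.card_range, nsmul_eq_mul]
    push_cast
    exact le_rfl
  filter_upwards [hconv, hBC] with ω h1 h2
  refine ⟨?_, h1⟩
  have hratio : ∀ N m i : ℕ, dyadicRatio β (fun t => ∑ k ∈ Finset.range N, F k t * g k ω) m i =
      if i < 2 ^ m then |∑ k ∈ Finset.range N,
        (F k ((i + 1) / 2 ^ m) - F k (i / 2 ^ m)) * g k ω| / ((m + 1) * q ^ m) else 0 := by
    intro N m i
    rw [dyadicRatio]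
    simp only [← Finset.sum_sub_distrib, ← sub_mul, hq]
  have hfix : ∀ m i : ℕ, BddAbove (range fun N =>
      dyadicRatio β (fun t => ∑ k ∈ Finset.range N, F k t * g k ω) m i) := by
    intro m i
    by_cases him : i < 2 ^ m
    · obtain ⟨l, hl⟩ := h1 m i him.le
      obtain ⟨l', hl'⟩ := h1 m (i + 1) him
      push_cast at hl'
      have := (((hl'.sub hl).abs).div_const ((m + 1) * q ^ m)).bddAbove_range
      simpa only [dyadicRatio, him, if_true] using this
    · simp only [dyadicRatio, him, if_false]
      exact ⟨0, by rintro _ ⟨N, rfl⟩; exact le_rfl⟩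
  -- On the finitely many bad levels there is no uniform estimate, but each of the finitely many
  -- increments converges in `N` and is therefore bounded. On all other levels `D` is a bound.
  have hfin : BddAbove (⋃ m ∈ {m : ℕ | ω ∈ ⋃ i ∈ Finset.range (2 ^ m), bad m i},
      ⋃ i ∈ Finset.range (2 ^ m), range fun N =>
        dyadicRatio β (fun t => ∑ k ∈ Finset.range N, F k t * g k ω) m i) := by
    rw [h2.bddAbove_biUnion]
    intro m _
    exact ((Finset.range (2 ^ m)).finite_toSet.bddAbove_biUnion).2 fun i _ => hfix m i
  refine (hfin.union (bddAbove_Iic (a := D))).mono ?_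
  rintro _ ⟨⟨N, m, i⟩, rfl⟩
  simp only
  by_cases him : i < 2 ^ m
  · by_cases hb : ω ∈ ⋃ i ∈ Finset.range (2 ^ m), bad m i
    · refine Or.inl (mem_biUnion (show m ∈ _ from hb) (mem_biUnion (show i ∈ _ from ?_) ⟨N, rfl⟩))
      exact Finset.mem_coe.2 (Finset.mem_range.2 him)
    · refine Or.inr ?_
      rw [mem_Iic, hratio, if_pos him, div_le_iff₀ (by positivity)]
      rcases N with _ | n
      · rw [Finset.range_zero, Finset.sum_empty, abs_zero]
        positivity
      · have hnot : ω ∉ bad m i := fun h =>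
          hb (mem_biUnion (show i ∈ _ from Finset.mem_coe.2 (Finset.mem_range.2 him)) h)
        have := not_le.1 (not_exists.1 hnot n)
        linarith
  · refine Or.inr ?_
    rw [mem_Iic, hratio, if_neg him]
    exact hDpos.le

end GaussianSeries

/-- The absolute moment of order `α` scales as the standard deviation to the power `α`, so the
normalization forces a common variance. -/
theorem gaussianReal_var_eq_of_integral_abs_rpow_eq_one {α : ℝ} (hα : 0 < α) {v w : ℝ≥0}
    (hv : ∫ x, |x| ^ α ∂gaussianReal 0 v = 1) (hw : ∫ x, |x| ^ α ∂gaussianReal 0 w = 1) :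
    v = w := by
  have hscale : ∀ u : ℝ≥0, ∫ x, |x| ^ α ∂gaussianReal 0 u =
      √u ^ α * ∫ x, |x| ^ α ∂gaussianReal 0 1 := by
    intro u
    have h := gaussianReal_map_const_mul (μ := 0) (v := 1) (√u)
    have hu : NNReal.mk (√u ^ 2) (sq_nonneg _) * 1 = u := by
      ext
      simp
    rw [mul_zero, hu] at h
    have hmeas : Measurable fun x : ℝ => |x| ^ α := by fun_prop
    rw [← h, integral_map (by fun_prop) hmeas.aestronglyMeasurable, ← integral_const_mul]
    refine integral_congr_ae (Eventually.of_forall fun x => ?_)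
    simp only [abs_mul, abs_of_nonneg (Real.sqrt_nonneg _)]
    rw [Real.mul_rpow (Real.sqrt_nonneg _) (abs_nonneg _)]
  rw [hscale] at hv hw
  have hne : ∫ x, |x| ^ α ∂gaussianReal 0 1 ≠ 0 := by
    intro h
    rw [h, mul_zero] at hv
    exact zero_ne_one hv
  have h := mul_right_cancel₀ hne (hv.trans hw.symm)
  have h2 := (Real.rpow_left_inj (Real.sqrt_nonneg _) (Real.sqrt_nonneg _) hα.ne').1 h
  have h3 := (Real.sqrt_inj v.2 w.2).1 h2
  exact NNReal.coe_injective h3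

/-! ### Square summability of the random Hölder constants -/

section LePage

variable {Ω : Type*} [MeasurableSpace Ω] {P : Measure Ω}
  {Γ : ℕ → Ω → ℝ} {ξ : ℕ → Ω → Plane} {φ : Plane → ℝ} {α : ℝ}

theorem sum_waitingTime {Ω : Type*} (Γ : ℕ → Ω → ℝ) (k : ℕ) (ω : Ω) :
    ∑ j ∈ Finset.range (k + 1), waitingTime Γ j ω = Γ k ω := by
  induction k with
  | zero => simp [waitingTime]
  | succ k ih =>
    rw [Finset.sum_range_succ, ih]
    simp [waitingTime]

theorem measurable_waitingTime (hΓ : ∀ k, Measurable (Γ k)) (k : ℕ) :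
    Measurable (waitingTime Γ k) := by
  unfold waitingTime
  split_ifs
  · exact hΓ 0
  · exact (hΓ k).sub (hΓ _)

theorem ae_pos_expMeasure : ∀ᵐ x ∂expMeasure 1, 0 < x := by
  have := isProbabilityMeasure_expMeasure one_pos
  rw [ae_iff]
  have h := ofReal_cdf (expMeasure 1) 0
  rw [cdf_expMeasure_eq one_pos] at h
  have e : {x : ℝ | ¬0 < x} = Iic 0 := by
    ext
    simp
  rw [e, ← h]
  simp

/-- The arrival times of a Poisson process grow at least linearly. -/
theorem ae_exists_mul_le_arrival [IsProbabilityMeasure P] (hΓ : IsUnitPoissonArrivals P Γ) :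
    ∀ᵐ ω ∂P, ∃ c > 0, ∀ᶠ k : ℕ in atTop, c * ((k : ℝ) + 1) ≤ Γ k ω := by
  have hW := measurable_waitingTime hΓ.measurable
  -- Truncation at one makes integrability trivial and keeps the mean positive; the strong law then
  -- gives linear growth from below, which is all that is needed.
  set X : ℕ → Ω → ℝ := fun k ω => min (waitingTime Γ k ω) 1 with hX
  have hXm : ∀ k, Measurable (X k) := fun k => (hW k).min measurable_const
  have hpos : ∀ᵐ ω ∂P, 0 < X 0 ω := by
    have h := ae_pos_expMeasure
    rw [← hΓ.law 0] at h
    filter_upwards [ae_of_ae_map (hW 0).aemeasurable h] with ω hω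
    exact lt_min hω one_pos
  have hint : Integrable (X 0) P := by
    refine (integrable_const (1 : ℝ)).mono' (hXm 0).aestronglyMeasurable ?_
    filter_upwards [hpos] with ω hω
    rw [Real.norm_of_nonneg hω.le]
    exact min_le_right _ _
  have hmean : 0 < ∫ ω, X 0 ω ∂P := by
    rw [integral_pos_iff_support_of_nonneg_ae (hpos.mono fun ω h => h.le) hint]
    have : P (Function.support (X 0)) = 1 := by
      rw [← prob_compl_eq_zero_iff (measurableSet_support (hXm 0))]
      exact measure_mono_null (fun ω hω h => hω (ne_of_gt h)) (ae_iff.1 hpos)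
    rw [this]
    exact one_pos
  have hident : ∀ i, IdentDistrib (X i) (X 0) P P := fun i =>
    IdentDistrib.comp (u := fun x => min x 1)
      ⟨(hW i).aemeasurable, (hW 0).aemeasurable, by rw [hΓ.law, hΓ.law]⟩ (by fun_prop)
  have hindep : iIndepFun X P := hΓ.indep.comp (fun _ x => min x 1) fun _ => by fun_prop
  filter_upwards [strong_law_ae_real X hint (fun i j hij => hindep.indepFun hij) hident] with ω hω
  refine ⟨(∫ ω, X 0 ω ∂P) / 2, half_pos hmean, ?_⟩
  have h1 := ((tendsto_add_atTop_iff_nat 1).2 hω).eventually (lt_mem_nhds (half_lt_self hmean))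
  filter_upwards [h1] with k hk
  have hk1 : (0 : ℝ) < (k : ℝ) + 1 := by positivity
  push_cast at hk
  rw [lt_div_iff₀ hk1] at hk
  rw [← sum_waitingTime Γ k ω]
  exact hk.le.trans (Finset.sum_le_sum fun j _ => min_le_left _ _)

/-- In polar coordinates of the plane the Jacobian `r` cancels the singularity `1 / r`. -/
theorem integrable_indicator_inv_sqrt_norm_sq (x : Plane) (ρ : ℝ) :
    Integrable fun y : Plane => (Iio ρ).indicator (fun r : ℝ => (√r)⁻¹) ‖x - y‖ ^ 2 := by
  have h : Integrable fun y : Plane => (Iio ρ).indicator (fun r : ℝ => (√r)⁻¹) ‖y‖ ^ 2 := by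
    rw [integrable_fun_norm_addHaar volume
      (f := fun r => (Iio ρ).indicator (fun r : ℝ => (√r)⁻¹) r ^ 2)]
    have h1 : IntegrableOn (fun _ : ℝ => (1 : ℝ)) (Iio ρ ∩ Ioi 0) := by
      rw [Iio_inter_Ioi]
      exact integrableOn_const (by simp)
    rw [← integrableOn_indicator_iff measurableSet_Iio] at h1
    refine h1.congr_fun (fun r hr => ?_) measurableSet_Ioi
    have hr0 : (0 : ℝ) < r := hr
    rw [finrank_euclideanSpace_fin, smul_eq_mul, indicator_apply, indicator_apply]
    split_ifs
    · rw [inv_pow, Real.sq_sqrt hr0.le, Nat.add_one_sub_one, pow_one, mul_inv_cancel₀ hr0.ne']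
    · simp
  exact h.comp_sub_left x

/-- The law contributes one factor `φ` and the weight contributes `φ^(-2/α)`. Their product is
continuous, hence bounded on the disc that carries the indicator. -/
theorem lintegral_point_lt_top (hφc : Continuous φ) (hφ : ∀ y, 0 < φ y) (x : Plane) (ρ : ℝ) :
    ∫⁻ y, ENNReal.ofReal ((φ y ^ (-(1 / α)) *
      (Iio ρ).indicator (fun r : ℝ => (√r)⁻¹) ‖x - y‖) ^ 2)
        ∂(volume.withDensity fun y => ENNReal.ofReal (φ y)) < ⊤ := by
  obtain ⟨M, hM⟩ := (isCompact_closedBall x ρ).exists_bound_of_continuousOn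
    (f := fun y => φ y * (φ y ^ (-(1 / α))) ^ 2)
    ((hφc.mul ((hφc.rpow_const fun y => Or.inl (hφ y).ne').pow 2)).continuousOn)
  have hm : Measurable fun y : Plane => (Iio ρ).indicator (fun r : ℝ => (√r)⁻¹) ‖x - y‖ := by
    have : Measurable ((Iio ρ).indicator fun r : ℝ => (√r)⁻¹) :=
      (by fun_prop : Measurable fun r : ℝ => (√r)⁻¹).indicator measurableSet_Iio
    exact this.comp (by fun_prop)
  have hφm := hφc.measurable
  rw [lintegral_withDensity_eq_lintegral_mul _ (by fun_prop) (by fun_prop)]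
  refine lt_of_le_of_lt (lintegral_mono fun y => ?_)
    ((integrable_indicator_inv_sqrt_norm_sq x ρ).const_mul M).lintegral_lt_top
  rw [Pi.mul_apply, ← ENNReal.ofReal_mul (hφ y).le]
  refine ENNReal.ofReal_le_ofReal ?_
  by_cases hy : ‖x - y‖ < ρ
  · rw [mul_pow, ← mul_assoc]
    refine mul_le_mul_of_nonneg_right ((le_abs_self _).trans (hM y ?_)) (sq_nonneg _)
    rw [mem_closedBall_iff_norm']
    exact hy.le
  · rw [indicator_of_notMem (by exact hy)]
    simp

/-- By Tonelli the expected sum is a constant times `∑ (k + 1)^(-2/α)`, and `2/α > 1`. -/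
theorem ae_summable_point (hα : α ∈ Ioo (0 : ℝ) 2) (hφc : Continuous φ) (hφ : ∀ y, 0 < φ y)
    (hξ : ∀ k, Measurable (ξ k))
    (hlaw : ∀ k, P.map (ξ k) = volume.withDensity (fun y => ENNReal.ofReal (φ y)))
    (x : Plane) (ρ : ℝ) :
    ∀ᵐ ω ∂P, Summable fun k : ℕ => (((k : ℝ) + 1) ^ (-(1 / α)) * (φ (ξ k ω) ^ (-(1 / α)) *
      (Iio ρ).indicator (fun r : ℝ => (√r)⁻¹) ‖x - ξ k ω‖)) ^ 2 := by
  have hm : Measurable fun y : Plane => (Iio ρ).indicator (fun r : ℝ => (√r)⁻¹) ‖x - y‖ := by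
    have : Measurable ((Iio ρ).indicator fun r : ℝ => (√r)⁻¹) :=
      (by fun_prop : Measurable fun r : ℝ => (√r)⁻¹).indicator measurableSet_Iio
    exact this.comp (by fun_prop)
  have hφm := hφc.measurable
  set H : Plane → ℝ := fun y => φ y ^ (-(1 / α)) *
    (Iio ρ).indicator (fun r : ℝ => (√r)⁻¹) ‖x - y‖
  have hH : Measurable H := by fun_prop
  have hlt := lintegral_point_lt_top (α := α) hφc hφ x ρ
  set I := ∫⁻ y, ENNReal.ofReal (H y ^ 2) ∂(volume.withDensity fun y => ENNReal.ofReal (φ y))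
  have hterm : ∀ k : ℕ, ∫⁻ ω, ENNReal.ofReal ((((k : ℝ) + 1) ^ (-(1 / α)) * H (ξ k ω)) ^ 2) ∂P =
      ENNReal.ofReal (((k : ℝ) + 1) ^ (-(2 / α))) * I := by
    intro k
    have e : ∀ ω, ENNReal.ofReal ((((k : ℝ) + 1) ^ (-(1 / α)) * H (ξ k ω)) ^ 2) =
        ENNReal.ofReal (((k : ℝ) + 1) ^ (-(2 / α))) * ENNReal.ofReal (H (ξ k ω) ^ 2) := by
      intro ω
      rw [mul_pow, ENNReal.ofReal_mul (by positivity), ← Real.rpow_natCast (_ ^ _),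
        ← Real.rpow_mul (by positivity)]
      congr 3
      push_cast
      ring
    simp_rw [e]
    rw [lintegral_const_mul _ (by have := hξ k; fun_prop)]
    congr 1
    change _ = lintegral (volume.withDensity fun y => ENNReal.ofReal (φ y)) _
    rw [← hlaw k, lintegral_map (by fun_prop) (hξ k)]
  have hsum : Summable fun k : ℕ => ((k : ℝ) + 1) ^ (-(2 / α)) := by
    have h1 : (1 : ℝ) < 2 / α := by
      rw [lt_div_iff₀ hα.1]
      linarith [hα.2]
    have := (summable_nat_add_iff 1).2 (Real.summable_nat_rpow.2 (neg_lt_neg h1))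
    simpa using this
  have hfin : ∫⁻ ω, ∑' k : ℕ, ENNReal.ofReal ((((k : ℝ) + 1) ^ (-(1 / α)) * H (ξ k ω)) ^ 2) ∂P
      ≠ ⊤ := by
    rw [lintegral_tsum fun k => by have := hξ k; fun_prop]
    simp_rw [hterm]
    rw [ENNReal.tsum_mul_right]
    exact ENNReal.mul_ne_top hsum.tsum_ofReal_ne_top hlt.ne
  filter_upwards [ae_lt_top (by fun_prop) hfin] with ω hω
  have := ENNReal.summable_toReal hω.ne
  refine this.congr fun k => ?_
  rw [ENNReal.toReal_ofReal (sq_nonneg _)]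

theorem ae_summable_lePage_sq [IsProbabilityMeasure P] (hα : α ∈ Ioo (0 : ℝ) 2) (hφc : Continuous φ) (hφ : ∀ y, 0 < φ y)
    (hξ : ∀ k, Measurable (ξ k))
    (hlaw : ∀ k, P.map (ξ k) = volume.withDensity (fun y => ENNReal.ofReal (φ y)))
    (hΓ : IsUnitPoissonArrivals P Γ) (x : Plane) (ρ : ℝ) :
    ∀ᵐ ω ∂P, Summable fun k : ℕ => (Γ k ω ^ (-(1 / α)) * φ (ξ k ω) ^ (-(1 / α)) *
      (Iio ρ).indicator (fun r : ℝ => (√r)⁻¹) ‖x - ξ k ω‖) ^ 2 := by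
  filter_upwards [ae_summable_point hα hφc hφ hξ hlaw x ρ, ae_exists_mul_le_arrival hΓ]
    with ω h1 ⟨c, hc, h2⟩
  refine (h1.mul_left ((c ^ (-(1 / α))) ^ 2)).of_norm_bounded_eventually_nat ?_
  filter_upwards [h2] with k hk
  rw [Real.norm_of_nonneg (sq_nonneg _), mul_assoc, mul_pow, mul_pow (((k : ℝ) + 1) ^ _),
    ← mul_assoc]
  refine mul_le_mul_of_nonneg_right ?_ (sq_nonneg _)
  rw [← mul_pow, ← Real.mul_rpow hc.le (by positivity)]
  have hpos : 0 < c * ((k : ℝ) + 1) := by positivity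
  refine pow_le_pow_left₀ (Real.rpow_nonneg (hpos.le.trans hk) _) ?_ 2
  refine Real.rpow_le_rpow_of_nonpos hpos hk ?_
  have := one_div_pos.2 hα.1
  linarith

theorem ae_point_ne (hξ : ∀ k, Measurable (ξ k))
    (hlaw : ∀ k, P.map (ξ k) = volume.withDensity (fun y => ENNReal.ofReal (φ y)))
    (x : Plane) : ∀ᵐ ω ∂P, ∀ k, ξ k ω ≠ x := by
  rw [ae_all_iff]
  intro k
  have h : ∀ᵐ y ∂P.map (ξ k), y ≠ x := by
    rw [hlaw]
    exact (withDensity_absolutelyContinuous _ _).ae_le (compl_mem_ae_iff.2 (measure_singleton x))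
  exact ae_of_ae_map (hξ k).aemeasurable h

end LePage

/-! ### Conditioning on an independent family -/

section Independence

variable {Ω 𝒳 𝒴 𝒵 : Type*} [MeasurableSpace Ω] [MeasurableSpace 𝒳] [MeasurableSpace 𝒴]
  [MeasurableSpace 𝒵] {P : Measure Ω} [IsProbabilityMeasure P]

/-- Fubini for the product law: `X` may be frozen while an independent copy of the randomness drives
`Y`. -/
theorem ae_mem_of_indepFun {X : Ω → 𝒳} {Y : Ω → 𝒴} (hX : Measurable X) (hY : Measurable Y)
    (h : IndepFun X Y P) {E : Set (𝒳 × 𝒴)} (hE : MeasurableSet E)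
    (hae : ∀ᵐ ω ∂P, ∀ᵐ ω' ∂P, (X ω, Y ω') ∈ E) : ∀ᵐ ω ∂P, (X ω, Y ω) ∈ E := by
  have := Measure.isProbabilityMeasure_map (μ := P) hY.aemeasurable
  have hmap := (indepFun_iff_map_prod_eq_prod_map_map hX.aemeasurable hY.aemeasurable).1 h
  have hzero : P.map (fun ω => (X ω, Y ω)) Eᶜ = 0 := by
    rw [hmap, Measure.prod_apply hE.compl,
      lintegral_map (measurable_measure_prodMk_left hE.compl) hX,
      lintegral_eq_zero_iff (f := fun ω => P.map Y (Prod.mk (X ω) ⁻¹' Eᶜ))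
        ((measurable_measure_prodMk_left hE.compl).comp hX)]
    filter_upwards [hae] with ω hω
    rw [Measure.map_apply hY (measurable_prodMk_left hE.compl)]
    exact hω
  exact ae_of_ae_map (p := fun z => z ∈ E) (hX.prodMk hY).aemeasurable (ae_iff.2 hzero)

theorem ProbabilityTheory.IndepFun.prodMk_left_of_prodMk_right {X : Ω → 𝒳} {Y : Ω → 𝒴} {Z : Ω → 𝒵}
    (hX : Measurable X) (hY : Measurable Y) (hZ : Measurable Z)
    (h : IndepFun X (fun ω => (Y ω, Z ω)) P) (h' : IndepFun Y Z P) :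
    IndepFun (fun ω => (X ω, Y ω)) Z P := by
  have := Measure.isProbabilityMeasure_map (μ := P) hY.aemeasurable
  have := Measure.isProbabilityMeasure_map (μ := P) hZ.aemeasurable
  have hXY : IndepFun X Y P := h.comp measurable_id measurable_fst
  rw [indepFun_iff_map_prod_eq_prod_map_map (by fun_prop) (by fun_prop)] at h h' hXY ⊢
  rw [h'] at h
  apply MeasurableEquiv.prodAssoc.map_measurableEquiv_injective
  rw [hXY, Measure.prodAssoc_prod, ← h, Measure.map_map (by fun_prop) (by fun_prop)]
  rfl

end Independence

/-! ### Comparison of moduli of continuity -/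

section Moduli

variable {β T : ℝ}

theorem exists_rpow_mul_log_le_rpow (hT : 0 < T) {κ : ℝ} (hκ : κ < β) :
    ∃ B : ℝ, 0 ≤ B ∧ ∀ h, 0 < h → h ≤ T → h ^ β * (1 + |Real.log h|) ≤ B * h ^ κ := by
  have hδ : 0 < β - κ := sub_pos.2 hκ
  refine ⟨1 + 1 / (β - κ) + T ^ (β - κ) * (1 + T), by positivity, fun h h0 hT' => ?_⟩
  have e : h ^ β = h ^ (β - κ) * h ^ κ := by rw [← Real.rpow_add h0, sub_add_cancel]
  rw [e, mul_right_comm]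
  refine mul_le_mul_of_nonneg_right ?_ (by positivity)
  rcases le_or_gt h 1 with h1 | h1
  · have hl := (Real.abs_log_mul_self_rpow_lt h (β - κ) h0 h1 hδ).le
    rw [abs_mul, abs_of_pos (Real.rpow_pos_of_pos h0 _)] at hl
    have hp := Real.rpow_le_one h0.le h1 hδ.le
    have : 0 ≤ T ^ (β - κ) * (1 + T) := by positivity
    linarith
  · have hl : |Real.log h| ≤ T := by
      rw [abs_of_pos (Real.log_pos h1)]
      linarith [Real.log_le_sub_one_of_pos h0]
    have : h ^ (β - κ) * (1 + |Real.log h|) ≤ T ^ (β - κ) * (1 + T) := by gcongr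
    have : 0 ≤ 1 + 1 / (β - κ) := by positivity
    linarith

/-- For `h ≤ 1/2` the logarithm is at least `log 2` in absolute value, which absorbs both the
summand one and the extra power `η / 2`. -/
theorem one_add_abs_log_le {η h : ℝ} (hη : 0 < η) (h0 : 0 < h) (h1 : h ≤ 1 / 2) :
    1 + |Real.log h| ≤
      (1 / Real.log 2 + 1) / Real.log 2 ^ (η / 2) * abs (Real.log h) ^ (1 + η / 2) := by
  have hl2 : 0 < Real.log 2 := Real.log_pos one_lt_two
  have hl : Real.log 2 ≤ |Real.log h| := by
    have := Real.log_le_log h0 h1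
    rw [one_div, Real.log_inv] at this
    exact le_trans (by linarith) (neg_le_abs _)
  set l := |Real.log h|
  have hlpos : 0 < l := hl2.trans_le hl
  have hp : Real.log 2 ^ (η / 2) ≤ l ^ (η / 2) := by gcongr
  have hpp : 0 < Real.log 2 ^ (η / 2) := by positivity
  rw [Real.rpow_add hlpos, Real.rpow_one, div_mul_eq_mul_div, le_div_iff₀ hpp]
  have h2 : 1 + l ≤ (1 / Real.log 2 + 1) * l := by
    rw [add_mul, one_mul, one_div_mul_eq_div]
    have := (one_le_div hl2).2 hl
    linarith
  calc (1 + l) * Real.log 2 ^ (η / 2) ≤ (1 / Real.log 2 + 1) * l * l ^ (η / 2) := by gcongr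
    _ = _ := by ring

theorem holderOnWith_of_abs_sub_le {f : ℝ → ℝ} {s : Set ℝ} {B : ℝ} (κ : ℝ≥0) (hB : 0 ≤ B)
    (h : ∀ x ∈ s, ∀ y ∈ s, 0 < |x - y| → |f x - f y| ≤ B * |x - y| ^ (κ : ℝ)) :
    HolderOnWith B.toNNReal κ f s := by
  intro x hx y hy
  rcases eq_or_ne x y with rfl | hxy
  · simp
  · have hpos : 0 < |x - y| := abs_pos.2 (sub_ne_zero.2 hxy)
    rw [edist_dist, edist_dist, Real.dist_eq, Real.dist_eq,
      ENNReal.ofReal_rpow_of_nonneg (abs_nonneg _) κ.coe_nonneg]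
    change _ ≤ ENNReal.ofReal B * _
    rw [← ENNReal.ofReal_mul hB]
    exact ENNReal.ofReal_le_ofReal (h x hx y hy hpos)

end Moduli

/-! ### Regularity of LePage series and of the candidate solution -/

section LePage

variable {α : ℝ} {φ : Plane → ℝ}

theorem lePagePartialSum_eq_sum {Ω : Type*} (Γ : ℕ → Ω → ℝ) (ξ : ℕ → Ω → Plane) (g : ℕ → Ω → ℝ)
    (f : Plane → ℝ) (N : ℕ) (ω : Ω) :
    lePagePartialSum α φ Γ ξ g f N ω = ∑ k ∈ Finset.range N,
      (lePageConst α * (Γ k ω ^ (-(1 / α)) * φ (ξ k ω) ^ (-(1 / α))) * f (ξ k ω)) * g k ω := by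
  rw [lePagePartialSum, Finset.mul_sum]
  exact Finset.sum_congr rfl fun k _ => by ring

theorem measurable_lePagePartialSum {Ω : Type*} [MeasurableSpace Ω] {Γ : ℕ → Ω → ℝ}
    {ξ : ℕ → Ω → Plane} {g : ℕ → Ω → ℝ} (hφ : Measurable φ) (hΓ : ∀ k, Measurable (Γ k))
    (hξ : ∀ k, Measurable (ξ k)) (hg : ∀ k, Measurable (g k)) {f : Plane → ℝ} (hf : Measurable f)
    (N : ℕ) : Measurable (lePagePartialSum α φ Γ ξ g f N) := by
  unfold lePagePartialSum
  refine Measurable.const_mul (Finset.measurable_sum _ fun k _ => ?_) _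
  have h1 := hΓ k
  have h2 := hξ k
  have h3 := hg k
  fun_prop

/-- The normalized dyadic increments of the partial sums of a family of LePage series indexed by
`[0, 1]`. -/
noncomputable def lePageDyadicRatio {Ω : Type*} (α : ℝ) (φ : Plane → ℝ) (Γ : ℕ → Ω → ℝ)
    (ξ : ℕ → Ω → Plane) (g : ℕ → Ω → ℝ) (f : ℝ → Plane → ℝ) (β : ℝ) (p : ℕ × ℕ × ℕ) (ω : Ω) : ℝ :=
  dyadicRatio β (fun u => lePagePartialSum α φ Γ ξ g (f u) p.1 ω) p.2.1 p.2.2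

/-- The outcomes for which the normalized dyadic increments are bounded and the series converges
at the dyadic points. -/
def lePageRegularSet {Ω : Type*} (α : ℝ) (φ : Plane → ℝ) (Γ : ℕ → Ω → ℝ)
    (ξ : ℕ → Ω → Plane) (g : ℕ → Ω → ℝ) (f : ℝ → Plane → ℝ) (β : ℝ) : Set Ω :=
  {ω | BddAbove (range fun p => lePageDyadicRatio α φ Γ ξ g f β p ω)} ∩
    ⋂ (m : ℕ) (i : ℕ) (_ : i ≤ 2 ^ m),
      {ω | ∃ l, Tendsto (fun N => lePagePartialSum α φ Γ ξ g (f (i / 2 ^ m)) N ω) atTop (𝓝 l)}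

theorem measurable_lePageDyadicRatio {Ω : Type*} [MeasurableSpace Ω] {Γ : ℕ → Ω → ℝ}
    {ξ : ℕ → Ω → Plane} {g : ℕ → Ω → ℝ} (hφ : Measurable φ) (hΓ : ∀ k, Measurable (Γ k))
    (hξ : ∀ k, Measurable (ξ k)) (hg : ∀ k, Measurable (g k)) {f : ℝ → Plane → ℝ}
    (hf : ∀ u, Measurable (f u)) (β : ℝ) (p : ℕ × ℕ × ℕ) :
    Measurable (lePageDyadicRatio α φ Γ ξ g f β p) := by
  unfold lePageDyadicRatio dyadicRatio
  split_ifs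
  · have h := fun u => measurable_lePagePartialSum (α := α) hφ hΓ hξ hg (hf u) p.1
    exact (((h _).sub (h _)).abs).div_const _
  · exact measurable_const

theorem measurableSet_lePageRegularSet {Ω : Type*} [MeasurableSpace Ω] {Γ : ℕ → Ω → ℝ}
    {ξ : ℕ → Ω → Plane} {g : ℕ → Ω → ℝ} (hφ : Measurable φ) (hΓ : ∀ k, Measurable (Γ k))
    (hξ : ∀ k, Measurable (ξ k)) (hg : ∀ k, Measurable (g k)) {f : ℝ → Plane → ℝ}
    (hf : ∀ u, Measurable (f u)) (β : ℝ) :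
    MeasurableSet (lePageRegularSet α φ Γ ξ g f β) := by
  refine MeasurableSet.inter
    (measurableSet_bddAbove_range fun p => measurable_lePageDyadicRatio hφ hΓ hξ hg hf β p) ?_
  refine MeasurableSet.iInter fun m => MeasurableSet.iInter fun i => MeasurableSet.iInter fun _ => ?_
  exact measurableSet_exists_tendsto fun N => measurable_lePagePartialSum hφ hΓ hξ hg (hf _) N

/-- If the weighted Hölder constants of the kernels are almost surely square summable, then the
LePage series is almost surely regular. -/
theorem ae_mem_lePageRegularSet {Ω : Type*} [MeasurableSpace Ω] {P : Measure Ω}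
    [IsProbabilityMeasure P] {Γ : ℕ → Ω → ℝ} {ξ : ℕ → Ω → Plane} {g : ℕ → Ω → ℝ}
    (hα : 0 < α) (hM : IsLePageSystem P α φ Γ ξ g) {f : ℝ → Plane → ℝ}
    (hf : ∀ u, Measurable (f u)) (hf0 : ∀ y, f 0 y = 0) {β : ℝ} (hβ : 0 < β) {b : Plane → ℝ}
    (hb : ∀ᵐ ω ∂P, ∀ k, ∀ s ∈ Icc (0 : ℝ) 1, ∀ t ∈ Icc (0 : ℝ) 1,
      |f t (ξ k ω) - f s (ξ k ω)| ≤ b (ξ k ω) * |t - s| ^ β)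
    (hsum : ∀ᵐ ω ∂P, Summable fun k : ℕ =>
      (Γ k ω ^ (-(1 / α)) * φ (ξ k ω) ^ (-(1 / α)) * b (ξ k ω)) ^ 2) :
    ∀ᵐ ω ∂P, ω ∈ lePageRegularSet α φ Γ ξ g f β := by
  have hφ := hM.density_continuous.measurable
  obtain ⟨v, hv⟩ : ∃ v : ℝ≥0, ∀ k, P.map (g k) = gaussianReal 0 v := by
    choose v hv using hM.gauss_law
    have hone : ∀ k, ∫ x, |x| ^ α ∂gaussianReal 0 (v k) = 1 := fun k => by
      have hmeas : Measurable fun x : ℝ => |x| ^ α := by fun_prop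
      rw [← hv k, integral_map (hM.gauss_measurable k).aemeasurable hmeas.aestronglyMeasurable]
      exact hM.gauss_moment k
    exact ⟨v 0, fun k => by
      rw [hv k, gaussianReal_var_eq_of_integral_abs_rpow_eq_one hα (hone k) (hone 0)]⟩
  have hΓm : Measurable fun ω k => Γ k ω := measurable_pi_lambda _ hM.arrivals.measurable
  have hξm : Measurable fun ω k => ξ k ω := measurable_pi_lambda _ hM.point_measurable
  have hgm : Measurable fun ω k => g k ω := measurable_pi_lambda _ hM.gauss_measurable
  have hindep := hM.indep_arrivals.prodMk_left_of_prodMk_right hΓm hξm hgm hM.indep_points_gauss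
  -- Regularity is a measurable event of the three sequences alone, so it can be read on the
  -- sequence space with `Γ` and `ξ` frozen and only `g` random.
  refine (ae_mem_of_indepFun (X := fun ω => ((fun k => Γ k ω), fun k => ξ k ω))
    (Y := fun ω k => g k ω) (hΓm.prodMk hξm) hgm hindep
    (E := lePageRegularSet α φ (fun k p => p.1.1 k) (fun k p => p.1.2 k) (fun k p => p.2 k) f β)
    (measurableSet_lePageRegularSet hφ (by fun_prop) (by fun_prop) (by fun_prop) hf β) ?_).mono fun ω h =>
    ⟨h.1, mem_iInter.2 fun m => mem_iInter.2 fun i => mem_iInter.2 fun hi =>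
      mem_iInter.1 (mem_iInter.1 (mem_iInter.1 h.2 m) i) hi⟩
  filter_upwards [hb, hsum] with ω hω1 hω2
  set C : ℕ → ℝ := fun k => lePageConst α * (Γ k ω ^ (-(1 / α)) * φ (ξ k ω) ^ (-(1 / α))) with hC
  have hcsum : Summable fun k => (|C k| * b (ξ k ω)) ^ 2 := by
    refine (hω2.mul_left (lePageConst α ^ 2)).congr fun k => ?_
    rw [mul_pow |C k|, sq_abs, hC]
    ring
  have hcore := ae_bddAbove_dyadicRatio (P := P) (F := fun k u => C k * f u (ξ k ω))
    (c := fun k => |C k| * b (ξ k ω)) (β := β)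
    hM.gauss_measurable hM.gauss_indep hv (fun k s hs t ht => by
      rw [← mul_sub, abs_mul, mul_assoc]
      exact mul_le_mul_of_nonneg_left (hω1 k s hs t ht) (abs_nonneg _))
    (fun k => by rw [hf0, mul_zero])
    (fun n => hcsum.sum_le_tsum _ fun k _ => sq_nonneg _) hβ
  filter_upwards [hcore] with ω' ⟨h1, h2⟩
  refine ⟨?_, ?_⟩
  · simp only [mem_ofPred_eq, lePageDyadicRatio, lePagePartialSum_eq_sum]
    exact h1
  · simp only [mem_iInter, mem_ofPred_eq, lePagePartialSum_eq_sum]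
    exact h2

/-- A purely pathwise statement: the supremum of the normalized increments bounds all partial sums
at once, so both convergence and modulus follow from chaining. -/
theorem lePageRegularSet_modulus {Ω : Type*} {Γ : ℕ → Ω → ℝ} {ξ : ℕ → Ω → Plane} {g : ℕ → Ω → ℝ}
    {f : ℝ → Plane → ℝ} {β : ℝ} (hβ : 0 < β) {ω : Ω}
    (hω : ω ∈ lePageRegularSet α φ Γ ξ g f β)
    (hc : ∀ k, ContinuousOn (fun u => f u (ξ k ω)) (Icc 0 1)) {K : ℝ}
    (hK : ∀ (f : ℝ → ℝ) (A : ℝ), 0 ≤ A → ContinuousOn f (Icc 0 1) →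
      (∀ m : ℕ, ∀ i : ℕ, i < 2 ^ m → |f ((i + 1) / 2 ^ m) - f (i / 2 ^ m)| ≤
        A * ((m + 1) * ((2 : ℝ) ^ (-β)) ^ m)) →
      ∀ s ∈ Icc (0 : ℝ) 1, ∀ t ∈ Icc (0 : ℝ) 1, 0 < |t - s| →
        |f t - f s| ≤ K * A * (|t - s| ^ β * (1 + abs (Real.log |t - s|)))) :
    (∀ u ∈ Icc (0 : ℝ) 1, Tendsto (fun N => lePagePartialSum α φ Γ ξ g (f u) N ω) atTop
      (𝓝 (lePageIntegral α φ Γ ξ g (f u) ω))) ∧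
    ∀ s ∈ Icc (0 : ℝ) 1, ∀ t ∈ Icc (0 : ℝ) 1, 0 < |t - s| →
      |lePageIntegral α φ Γ ξ g (f t) ω - lePageIntegral α φ Γ ξ g (f s) ω| ≤
        K * (⨆ p, lePageDyadicRatio α φ Γ ξ g f β p ω) *
          (|t - s| ^ β * (1 + abs (Real.log |t - s|))) := by
  obtain ⟨hbdd, hdy⟩ := hω
  simp only [mem_iInter] at hdy
  set A := ⨆ p, lePageDyadicRatio α φ Γ ξ g f β p ω
  have hA : 0 ≤ A := Real.iSup_nonneg fun p => dyadicRatio_nonneg _ _ _ _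
  have hcN : ∀ N, ContinuousOn (fun u => lePagePartialSum α φ Γ ξ g (f u) N ω) (Icc 0 1) := by
    intro N
    simp only [lePagePartialSum_eq_sum]
    exact continuousOn_finsetSum _ fun k _ => (continuousOn_const.mul (hc k)).mul continuousOn_const
  have hinc : ∀ N, ∀ m i : ℕ, i < 2 ^ m →
      |lePagePartialSum α φ Γ ξ g (f ((i + 1) / 2 ^ m)) N ω -
        lePagePartialSum α φ Γ ξ g (f (i / 2 ^ m)) N ω| ≤
      A * ((m + 1) * ((2 : ℝ) ^ (-β)) ^ m) := by
    intro N m i him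
    have h := le_ciSup hbdd (N, m, i)
    simp only [lePageDyadicRatio, dyadicRatio, him, if_true] at h
    rwa [div_le_iff₀ (by positivity)] at h
  have hlim : ∀ u ∈ Icc (0 : ℝ) 1, Tendsto (fun N => lePagePartialSum α φ Γ ξ g (f u) N ω) atTop
      (𝓝 (lePageIntegral α φ Γ ξ g (f u) ω)) := fun u hu =>
    tendsto_nhds_limUnder (exists_tendsto_of_dyadic
      (S := fun N u => lePagePartialSum α φ Γ ξ g (f u) N ω) (by positivity)
      (Real.rpow_lt_one_of_one_lt_of_neg one_lt_two (neg_lt_zero.2 hβ)) hA hcN hinc hdy hu)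
  refine ⟨hlim, fun s hs t ht hst => ?_⟩
  exact le_of_tendsto' ((hlim t ht).sub (hlim s hs)).abs fun N =>
    hK (fun u => lePagePartialSum α φ Γ ξ g (f u) N ω) A hA (hcN N) (hinc N) s hs t ht hst

end LePage

/-- The candidate solution has modulus of continuity `O(h ^ β (1 + |log h|))` in time. -/
theorem exists_candidateSolution_modulus {Ω : Type*} [MeasurableSpace Ω] {P : Measure Ω}
    [IsProbabilityMeasure P] {α : ℝ} (hα : α ∈ Ioo (0 : ℝ) 2) {φ : Plane → ℝ} {Γ : ℕ → Ω → ℝ}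
    {ξ : ℕ → Ω → Plane} {g : ℕ → Ω → ℝ} (hM : IsLePageSystem P α φ Γ ξ g)
    {a : ℝ} (ha : 0 < a) {σ : Plane → ℝ → ℝ}
    (hS1 : ∃ K : ℝ, ∀ (y : Plane) (t : ℝ), 0 ≤ t → |σ y t| ≤ K)
    (hS2 : ContinuousOn (fun p : Plane × ℝ => σ p.1 p.2) (univ ×ˢ Ici (0 : ℝ)))
    {γ : ℝ} (hγ : 0 < γ)
    (hS3 : ∃ L : ℝ, ∀ (y : Plane) (t s : ℝ), 0 ≤ t → 0 ≤ s → |σ y t - σ y s| ≤ L * |t - s| ^ γ)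
    {T : ℝ} (hT : 0 < T) (x : Plane) :
    ∃ A : Ω → ℝ, Measurable A ∧ (∀ ω, 0 ≤ A ω) ∧ ∀ᵐ ω ∂P,
      (∀ t ∈ Icc (0 : ℝ) T,
        Tendsto (fun N => lePagePartialSum α φ Γ ξ g (fun y => waveKernel a σ x y t) N ω) atTop
          (𝓝 (candidateSolution α φ Γ ξ g a σ x t ω))) ∧
      ∀ t₁ ∈ Icc (0 : ℝ) T, ∀ t₂ ∈ Icc (0 : ℝ) T, 0 < |t₁ - t₂| →
        |candidateSolution α φ Γ ξ g a σ x t₁ ω - candidateSolution α φ Γ ξ g a σ x t₂ ω| ≤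
          A ω * (|t₁ - t₂| ^ min γ (1 / 2) * (1 + abs (Real.log |t₁ - t₂|))) := by
  set β := min γ (1 / 2)
  have hβ : 0 < β := lt_min hγ (by norm_num)
  have hc : ∀ y, ContinuousOn (σ y) (Ici 0) := fun y =>
    hS2.comp (f := fun t : ℝ => (y, t)) (by fun_prop) fun t ht => ⟨mem_univ _, ht⟩
  -- Time is rescaled to the unit interval, on which the chaining is set up.
  set f : ℝ → Plane → ℝ := fun u y => waveKernel a σ x y (T * u) with hf
  have hfm : ∀ u, Measurable (f u) := fun u => measurable_waveKernel ha hS2 x _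
  have hf0 : ∀ y, f 0 y = 0 := fun y => waveKernel_eq_zero (by simp)
  obtain ⟨D, hD, hDle⟩ := exists_abs_waveKernel_sub_le (T := T) ha hc hγ hS1 hS3 x
  obtain ⟨K, hK0, hK⟩ := exists_abs_sub_le_rpow_mul_log hβ
  set b : Plane → ℝ := fun y =>
    D * T ^ β * (Iio (a * T)).indicator (fun r : ℝ => (√r)⁻¹) ‖x - y‖ with hb
  have hfb : ∀ᵐ ω ∂P, ∀ k, ∀ s ∈ Icc (0 : ℝ) 1, ∀ t ∈ Icc (0 : ℝ) 1,
      |f t (ξ k ω) - f s (ξ k ω)| ≤ b (ξ k ω) * |t - s| ^ β := by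
    filter_upwards [ae_point_ne hM.point_measurable hM.point_law x] with ω hω k s hs t ht
    have hmem : ∀ u ∈ Icc (0 : ℝ) 1, T * u ∈ Icc 0 T := fun u hu =>
      ⟨mul_nonneg hT.le hu.1, mul_le_of_le_one_right hT.le hu.2⟩
    have hpos : 0 < ‖x - ξ k ω‖ := norm_pos_iff.2 (sub_ne_zero.2 (hω k).symm)
    refine (hDle _ hpos _ (hmem s hs) _ (hmem t ht)).trans (le_of_eq ?_)
    rw [← mul_sub, abs_mul, abs_of_pos hT, Real.mul_rpow hT.le (abs_nonneg _)]
    ring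
  have hsum : ∀ᵐ ω ∂P, Summable fun k : ℕ =>
      (Γ k ω ^ (-(1 / α)) * φ (ξ k ω) ^ (-(1 / α)) * b (ξ k ω)) ^ 2 := by
    filter_upwards [ae_summable_lePage_sq hα hM.density_continuous hM.density_pos
      hM.point_measurable hM.point_law hM.arrivals x (a * T)] with ω hω
    refine (hω.mul_left ((D * T ^ β) ^ 2)).congr fun k => ?_
    rw [hb]
    ring
  have hreg := ae_mem_lePageRegularSet hα.1 hM hfm hf0 hβ hfb hsum
  have hAm : Measurable fun ω => ⨆ p, lePageDyadicRatio α φ Γ ξ g f β p ω :=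
    Measurable.iSup fun p => measurable_lePageDyadicRatio hM.density_continuous.measurable
      hM.arrivals.measurable hM.point_measurable hM.gauss_measurable hfm β p
  -- The last factor undoes the time scaling in the power and in the logarithm. The supremum is over
  -- a countable index set, hence measurable, and it is nonnegative even where its default value
  -- zero is taken.
  refine ⟨fun ω => K * (⨆ p, lePageDyadicRatio α φ Γ ξ g f β p ω) *
    (T⁻¹ ^ β * (1 + |Real.log T|)), (hAm.const_mul K).mul_const _, fun ω => ?_, ?_⟩
  · have := Real.iSup_nonneg (f := fun p => lePageDyadicRatio α φ Γ ξ g f β p ω)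
      fun p => dyadicRatio_nonneg _ _ _ _
    positivity
  filter_upwards [hreg, hfb] with ω hω hω2
  have hcont : ∀ k, ContinuousOn (fun u => f u (ξ k ω)) (Icc 0 1) := by
    intro k s hs
    rw [ContinuousWithinAt, tendsto_iff_dist_tendsto_zero]
    have hlim : Tendsto (fun t : ℝ => b (ξ k ω) * |t - s| ^ β) (𝓝[Icc 0 1] s) (𝓝 0) := by
      have hcs : Continuous fun t : ℝ => b (ξ k ω) * |t - s| ^ β :=
        continuous_const.mul ((by fun_prop : Continuous fun t : ℝ => |t - s|).rpow_const
          fun _ => Or.inr hβ.le)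
      have := (hcs.tendsto s).mono_left (nhdsWithin_le_nhds (s := Icc 0 1))
      simpa [Real.zero_rpow hβ.ne'] using this
    refine squeeze_zero' (Eventually.of_forall fun t => dist_nonneg) ?_ hlim
    filter_upwards [self_mem_nhdsWithin] with t ht
    exact hω2 k s hs t ht
  obtain ⟨h1, h2⟩ := lePageRegularSet_modulus hβ hω hcont hK
  have hdiv : ∀ t ∈ Icc (0 : ℝ) T, t / T ∈ Icc (0 : ℝ) 1 := fun t ht =>
    ⟨div_nonneg ht.1 hT.le, (div_le_one hT).2 ht.2⟩
  have hfT : ∀ t, f (t / T) = fun y => waveKernel a σ x y t := fun t => by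
    rw [hf]
    simp only [mul_div_cancel₀ t hT.ne']
  refine ⟨fun t ht => ?_, fun t₁ ht₁ t₂ ht₂ hne => ?_⟩
  · have := h1 _ (hdiv t ht)
    rwa [hfT] at this
  · have hsub : |t₁ / T - t₂ / T| = |t₁ - t₂| * T⁻¹ := by
      rw [← sub_div, abs_div, abs_of_pos hT, div_eq_mul_inv]
    have h := h2 _ (hdiv t₂ ht₂) _ (hdiv t₁ ht₁)
      (by rw [hsub]; positivity)
    rw [hfT, hfT, hsub] at h
    refine h.trans ?_
    have hA := Real.iSup_nonneg (f := fun p => lePageDyadicRatio α φ Γ ξ g f β p ω)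
      fun p => dyadicRatio_nonneg _ _ _ _
    have hlog : 1 + abs (Real.log (|t₁ - t₂| * T⁻¹)) ≤
        (1 + |Real.log T|) * (1 + abs (Real.log |t₁ - t₂|)) := by
      rw [Real.log_mul hne.ne' (inv_pos.2 hT).ne', Real.log_inv]
      have := abs_add_le (Real.log |t₁ - t₂|) (-Real.log T)
      rw [abs_neg] at this
      have h3 : 0 ≤ |Real.log T| * abs (Real.log |t₁ - t₂|) := by positivity
      linarith
    calc K * (⨆ p, lePageDyadicRatio α φ Γ ξ g f β p ω) *
          ((|t₁ - t₂| * T⁻¹) ^ β * (1 + abs (Real.log (|t₁ - t₂| * T⁻¹))))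
        ≤ K * (⨆ p, lePageDyadicRatio α φ Γ ξ g f β p ω) *
          ((|t₁ - t₂| * T⁻¹) ^ β * ((1 + |Real.log T|) * (1 + abs (Real.log |t₁ - t₂|)))) := by
          gcongr
      _ = _ := by
        rw [Real.mul_rpow hne.le (inv_pos.2 hT).le]
        ring

theorem theorem4 {Ω : Type*} [MeasurableSpace Ω] (P : Measure Ω) [IsProbabilityMeasure P]
    (α : ℝ) (hα : α ∈ Ioo (0 : ℝ) 2)
    (φ : Plane → ℝ) (Γ : ℕ → Ω → ℝ) (ξ : ℕ → Ω → Plane) (g : ℕ → Ω → ℝ)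
    (hM : IsLePageSystem P α φ Γ ξ g)
    (a : ℝ) (ha : 0 < a) (σ : Plane → ℝ → ℝ)
    (hS1 : ∃ K : ℝ, ∀ (y : Plane) (t : ℝ), 0 ≤ t → |σ y t| ≤ K)
    (hS2 : ContinuousOn (fun p : Plane × ℝ => σ p.1 p.2) (univ ×ˢ Ici (0 : ℝ)))
    (γ : ℝ) (hγ : γ ∈ Ioc (0 : ℝ) 1)
    (hS3 : ∃ L : ℝ, ∀ (y : Plane) (t s : ℝ), 0 ≤ t → 0 ≤ s → |σ y t - σ y s| ≤ L * |t - s| ^ γ)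
    (T : ℝ) (hT : 0 < T) (x : Plane) :
    (∀ᵐ ω ∂P,
      (∀ t ∈ Icc (0 : ℝ) T,
        Tendsto (fun N => lePagePartialSum α φ Γ ξ g (fun y => waveKernel a σ x y t) N ω) atTop
          (𝓝 (candidateSolution α φ Γ ξ g a σ x t ω))) ∧
      ∀ κ : ℝ≥0, (κ : ℝ) < min γ (1 / 2) →
        ∃ C : ℝ≥0, HolderOnWith C κ (fun t => candidateSolution α φ Γ ξ g a σ x t ω)
          (Icc (0 : ℝ) T)) ∧
    ∀ η : ℝ, 0 < η →
      ∃ C : Ω → ℝ, Measurable C ∧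
        ∀ᵐ ω ∂P, ∀ t₁ ∈ Icc (0 : ℝ) T, ∀ t₂ ∈ Icc (0 : ℝ) T, 0 < |t₁ - t₂| → |t₁ - t₂| ≤ 1 / 2 →
          |candidateSolution α φ Γ ξ g a σ x t₁ ω - candidateSolution α φ Γ ξ g a σ x t₂ ω| ≤
            C ω * |t₁ - t₂| ^ min γ (1 / 2) * abs (Real.log |t₁ - t₂|) ^ (1 + η / 2) := by
  obtain ⟨A, hAm, hA0, hA⟩ := exists_candidateSolution_modulus hα hM ha hS1 hS2 hγ.1 hS3 hT x
  refine ⟨?_, fun η hη => ?_⟩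
  · filter_upwards [hA] with ω ⟨h1, h2⟩
    refine ⟨h1, fun κ hκ => ?_⟩
    obtain ⟨B, hB, hBle⟩ := exists_rpow_mul_log_le_rpow hT hκ
    refine ⟨_, holderOnWith_of_abs_sub_le κ (mul_nonneg (hA0 ω) hB) fun s hs t ht hst => ?_⟩
    have hle : |s - t| ≤ T := abs_le.2 ⟨by linarith [hs.1, ht.2], by linarith [ht.1, hs.2]⟩
    rw [mul_assoc]
    exact (h2 s hs t ht hst).trans (mul_le_mul_of_nonneg_left (hBle _ hst hle) (hA0 ω))
  · refine ⟨fun ω => A ω * ((1 / Real.log 2 + 1) / Real.log 2 ^ (η / 2)), hAm.mul_const _, ?_⟩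
    filter_upwards [hA] with ω ⟨_, h2⟩ t₁ ht₁ t₂ ht₂ hpos hhalf
    refine (h2 t₁ ht₁ t₂ ht₂ hpos).trans ?_
    have hlog := one_add_abs_log_le hη hpos hhalf
    have hAω := hA0 ω
    calc A ω * (|t₁ - t₂| ^ min γ (1 / 2) * (1 + abs (Real.log |t₁ - t₂|)))
        ≤ A ω * (|t₁ - t₂| ^ min γ (1 / 2) * ((1 / Real.log 2 + 1) / Real.log 2 ^ (η / 2) *
          abs (Real.log |t₁ - t₂|) ^ (1 + η / 2))) := by gcongr
      _ = _ := by ring
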